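/- **Setting.** Let $(\mathcal A,\mathcal H,D,J)$ be a $U(1)$-equivariant real spectral triple over a unital $*$-algebra $\mathcal A$, with $J^2=-1$ and $JD=DJ$. That is: $\pi:\mathcal A\to B(\mathcal H)$ is a unital $*$-representation (omitted from the notation); $D$ is selfadjoint with compact resolvent; each $a\in\mathcal A$ preserves $\mathrm{Dom}(D)$ and $[D,a]$ is bounded; $J$ is antiunitary, with $[a,Jb^*J^{-1}]=0$ and $[[D,a],Jb^*J^{-1}]=0$ for all $a,b\in\mathcal A$. A strongly continuous unitary representation of $U(1)$ on $\mathcal H$ commutes with $D$ and $J$; $\delta$ is its selfadjoint generator and $\mathcal H_k=\ker(\delta-k)$, $k\in\mathbb Z$. The $U(1)$-action on $\mathcal A$ is generated by a derivation, also written $\delta$, with $\delta(a^*)=-\delta(a)^*$ and $[\delta,\pi(a)]=\pi(\delta(a))$; put $\mathcal A^{(k)}=\{a:\delta(a)=ka\}$ and $\mathcal B=\mathcal A^{(0)}$. Assume: 1. *(principal bundle)* the algebra of finite sums of homogeneous elements is a Hopf–Galois extension of $\mathcal B$ for the Hopf algebra $\mathbb C[z,z^{-1}]$: the canonical map $a'\otimes_{\mathcal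 B}a\mapsto a'a\otimes z^k$ ($a\in\mathcal A^{(k)}$) is bijective. 2. *(projectability)* there is $\Gamma=\Gamma^*$ with $\Gamma^2=1$, $\Gamma J=-J\Gamma$, commuting with $\mathcal A$ and $\delta$ and preserving $\mathrm{Dom}(D)$. Put $D_h=\tfrac12\Gamma[\Gamma,D]$ and $D_0=D_h|_{\mathcal H_0}$. Assume $[D_h,b]=[D,b]$ for $b\in\mathcal B$. 3. *(fibres of constant length $2\pi$)* $D-D_h-\Gamma\delta$ is bounded on its natural domain, with bounded extension $Z$, and $[Z,Ja^*J^{-1}]=0$ for all $a\in\mathcal A$. 4. *(calculus)* $\sum_i p_i[D,q_i]=0$ implies $\sum_i p_i\delta(q_i)=0$, for $p_i,q_i\in\mathcal A$. For a subalgebra $\mathcal C\subset\mathcal A$ let $\Omega^1_D(\mathcal C)$ be the space of finite sums $\sum_i p_i[D,q_i]$ with $p_i,q_i\in\mathcal C$. Let $\omega\in\Omega^1_D(\mathcal A)$ be a strong principal connection: $[\delta,\omega]=0$; if $\omega=\sum_i p_i[D,q_i]$ then $\sum_i p_i\delta(q_i)=1$; and $[D,a]-\delta(a)\omega\in\Omega^1_D(\mathcal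 B)\mathcal A$ for all $a\in\mathcal A$. Elements $p\in\mathcal A$ and one-forms $\eta$ act from the right on $\mathcal H$ by $hp=Jp^*J^{-1}h$ and $h\eta=-J\eta^*J^{-1}h$. Let $\nabla_\omega(p)=[D,p]-kp\,\omega$ for $p\in\mathcal A^{(k)}$. Let $D^{(k)}_\omega$ be the closure of the operator $$hp\longmapsto (D_0h)p+h\nabla_\omega(p),\qquad h\in\mathrm{Dom}(D_0)=\mathrm{Dom}(D_h)\cap\mathcal H_0,\quad p\in\mathcal A^{(k)},$$ defined on the linear span of the vectors $hp$ in $\mathcal H_k$, and let the twisted Dirac operator $D_\omega$ be the closure of $\bigoplus_{k\in\mathbb Z}D^{(k)}_\omega$. **Proposition.** The operators $D_\omega^{(k)}$ and $D_\omega$ are well defined (the prescriptions are single-valued and closable), and $\mathrm{Dom}(D)\subset\mathrm{Dom}(\delta)$. On each $\mathcal H_k$ the operator $D_\omega^{(k)}$ is the restriction of $D+J\omega^*J^{-1}\delta-Z$ (with domain $\mathrm{Dom}(D)$) to $\mathrm{Dom}(D)\cap\mathcal H_k$. The operator $D+J\omega^*J^{-1}\delta-Z$ is closable, and $D_\omega$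 is its closure. If $\omega$ is selfadjoint, then $D_\omega$ is selfadjoint. Every $a\in\mathcal A$ preserves $\mathrm{Dom}(D_\omega)$, and $[D_\omega,a]$ is bounded. -/

import Mathlib

open scoped TensorProduct DirectSum

noncomputable section

namespace TwistedDirac

section Operators

variable {H : Type*} [NormedAddCommGroup H] [InnerProductSpace ℂ H] [CompleteSpace H]

/-- `[D, T]` is defined on `Dom D` and is the restriction of the bounded operator `C`. -/
def IsCommutator (D : H →ₗ.[ℂ] H) (T C : H →L[ℂ] H) : Prop :=
  ∀ x : D.domain, ∃ h : T x ∈ D.domain, D ⟨T x, h⟩ - T (D x) = C x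

/-- `T` preserves `Dom D` and `[D, T]` is bounded on `Dom D`. -/
def HasBoundedCommutator (D : H →ₗ.[ℂ] H) (T : H →L[ℂ] H) : Prop :=
  ∃ C : H →L[ℂ] H, IsCommutator D T C

open Classical in
/-- The bounded extension of `[D, T]`. It is unique when `D` is densely defined; the value is `0`
if `[D, T]` is not bounded. -/
def boundedCommutator (D : H →ₗ.[ℂ] H) (T : H →L[ℂ] H) : H →L[ℂ] H :=
  if h : HasBoundedCommutator D T then h.choose else 0

/-- The operator `D` has compact resolvent: for some `z`, `(D - z)⁻¹` exists and is compact. -/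
def HasCompactResolvent (D : H →ₗ.[ℂ] H) : Prop :=
  ∃ (z : ℂ) (R : H →L[ℂ] H), IsCompactOperator R ∧
    (∀ x : H, ∃ h : R x ∈ D.domain, D ⟨R x, h⟩ - z • R x = x) ∧
    (∀ x : D.domain, R (D x - z • (x : H)) = x)

/-- The infinitesimal generator `δ` of a unitary representation of `U(1)`, with
`U (exp (it)) = exp (it δ)`: one has `x ∈ Dom δ` and `δ x = y` when the orbit
`t ↦ U (exp (it)) x` has derivative `i y` at `t = 0`. -/
def generator (U : Circle →* (H ≃ₗᵢ[ℂ] H)) : H →ₗ.[ℂ] H where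
  domain :=
    { carrier := {x | DifferentiableAt ℝ (fun t : ℝ => U (Circle.exp t) x) 0}
      zero_mem' := by simp
      add_mem' := by
        intro a b ha hb
        simp only [Set.mem_ofPred_eq, map_add] at *
        exact ha.fun_add hb
      smul_mem' := by
        intro c x hx
        simp only [Set.mem_ofPred_eq, map_smul] at *
        exact hx.fun_const_smul c }
  toFun :=
    { toFun := fun x => -Complex.I • deriv (fun t : ℝ => U (Circle.exp t) (x : H)) 0
      map_add' := by
        rintro ⟨a, ha⟩ ⟨b, hb⟩
        have ha' : DifferentiableAt ℝ (fun t : ℝ => U (Circle.exp t) a) 0 := ha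
        have hb' : DifferentiableAt ℝ (fun t : ℝ => U (Circle.exp t) b) 0 := hb
        simp only [Submodule.coe_add, map_add]
        rw [deriv_fun_add ha' hb', smul_add]
      map_smul' := by
        rintro c ⟨x, hx⟩
        have hx' : DifferentiableAt ℝ (fun t : ℝ => U (Circle.exp t) x) 0 := hx
        simp only [Submodule.coe_smul, map_smul, RingHom.id_apply]
        rw [deriv_fun_const_smul c hx', smul_comm] }

/-- The eigenspace of an unbounded operator `T` for the eigenvalue `c`. -/
def eigenspace (T : H →ₗ.[ℂ] H) (c : ℂ) : Submodule ℂ H where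
  carrier := {x | ∃ h : x ∈ T.domain, T ⟨x, h⟩ = c • x}
  zero_mem' := ⟨T.domain.zero_mem, by
    have : (⟨0, T.domain.zero_mem⟩ : T.domain) = 0 := rfl
    rw [this, T.map_zero, smul_zero]⟩
  add_mem' := by
    rintro a b ⟨ha, ea⟩ ⟨hb, eb⟩
    refine ⟨T.domain.add_mem ha hb, ?_⟩
    have : (⟨a + b, T.domain.add_mem ha hb⟩ : T.domain) = ⟨a, ha⟩ + ⟨b, hb⟩ := rfl
    rw [this, T.map_add, ea, eb, smul_add]
  smul_mem' := by
    rintro d x ⟨hx, ex⟩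
    refine ⟨T.domain.smul_mem d hx, ?_⟩
    have : (⟨d • x, T.domain.smul_mem d hx⟩ : T.domain) = d • ⟨x, hx⟩ := rfl
    rw [this, T.map_smul, ex, smul_comm]

/-- `J T J⁻¹` for an antiunitary `J`. -/
def antiConj (J : H ≃ₗᵢ⋆[ℂ] H) (T : H →L[ℂ] H) : H →L[ℂ] H :=
  (J.toContinuousLinearEquiv : H →L⋆[ℂ] H).comp
    (T.comp (J.symm.toContinuousLinearEquiv : H →L⋆[ℂ] H))

end Operators

/-- A `U(1)`-equivariant real spectral triple `(A, H, D, J)` over a unital `*`-algebra `A`, with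
the signs `J² = -1`, `J D = D J` (those of dimension three).

The `U(1)`-action on `A` enters through its derivation `δ = -i d/dφ`, here called `derivA`. -/
structure EquivariantRealSpectralTriple (A H : Type*) [Ring A] [StarRing A] [Algebra ℂ A]
    [StarModule ℂ A] [NormedAddCommGroup H] [InnerProductSpace ℂ H] [CompleteSpace H] where
  /-- the derivation of the algebra generating the `U(1)`-action -/
  derivA : A →ₗ[ℂ] A
  derivA_mul : ∀ a b, derivA (a * b) = derivA a * b + a * derivA b
  derivA_star : ∀ a, derivA (star a) = -star (derivA a)
  /-- the representation of the algebra -/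
  rep : A →⋆ₐ[ℂ] (H →L[ℂ] H)
  /-- the Dirac operator -/
  D : H →ₗ.[ℂ] H
  D_selfAdjoint : IsSelfAdjoint D
  D_compactResolvent : HasCompactResolvent D
  D_boundedCommutator : ∀ a, HasBoundedCommutator D (rep a)
  /-- the reality structure -/
  J : H ≃ₗᵢ⋆[ℂ] H
  J_sq : ∀ x, J (J x) = -x
  J_D : ∀ x : D.domain, ∃ h : J x ∈ D.domain, D ⟨J x, h⟩ = J (D x)
  order_zero : ∀ a b, Commute (rep a) (antiConj J (rep (star b)))
  order_one : ∀ a b, Commute (boundedCommutator D (rep a)) (antiConj J (rep (star b)))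
  /-- the unitary representation of `U(1)` on the Hilbert space -/
  U : Circle →* (H ≃ₗᵢ[ℂ] H)
  U_continuous : ∀ x, Continuous fun z => U z x
  D_equivariant : ∀ (z : Circle) (x : D.domain),
    ∃ h : U z x ∈ D.domain, D ⟨U z x, h⟩ = U z (D x)
  J_equivariant : ∀ (z : Circle) (x : H), J (U z x) = U z (J x)
  /-- `[δ, π(a)] = π(δ(a))` -/
  rep_equivariant : ∀ a, IsCommutator (generator U) (rep a) (rep (derivA a))

namespace EquivariantRealSpectralTriple

variable {A H : Type*} [Ring A] [StarRing A] [Algebra ℂ A] [StarModule ℂ A]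
  [NormedAddCommGroup H] [InnerProductSpace ℂ H] [CompleteSpace H]
  (S : EquivariantRealSpectralTriple A H)

section HopfGalois

/-- `A⁽ᵏ⁾`, the homogeneous elements of degree `k`: the solutions of `δ(a) = k a`. The algebra of
invariant elements is `B = A⁽⁰⁾`. -/
def homog (k : ℤ) : Submodule ℂ A :=
  Module.End.eigenspace S.derivA (k : ℂ)

theorem mem_homog {k : ℤ} {a : A} : a ∈ S.homog k ↔ S.derivA a = (k : ℂ) • a :=
  Module.End.mem_eigenspace_iff

instance homog_gradedMonoid : SetLike.GradedMonoid S.homog where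
  one_mem := by
    rw [mem_homog]
    have h := S.derivA_mul 1 1
    simp only [mul_one, one_mul] at h
    simpa using h
  mul_mem := by
    intro i j a b ha hb
    rw [mem_homog] at *
    rw [S.derivA_mul, ha, hb, smul_mul_assoc, mul_smul_comm, ← add_smul]
    push_cast
    rfl

/-- The algebra of polynomial elements, that is, of finite sums of homogeneous elements. It is a
comodule algebra over the Hopf algebra `ℂ[z, z⁻¹]` of polynomials on `U(1)`, and it is the whole
algebra when that is spanned by homogeneous elements. -/
def Pol : Subalgebra ℂ A :=
  (⨆ k : ℤ, S.homog k).toSubalgebra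
    (Submodule.mem_iSup_of_mem 0 (SetLike.GradedOne.one_mem (A := S.homog)))
    (by
      intro x y hx hy
      induction hx using Submodule.iSup_induction' with
      | zero => rw [zero_mul]; exact Submodule.zero_mem _
      | add x x' _ _ h h' => rw [add_mul]; exact Submodule.add_mem _ h h'
      | mem i x hx =>
        induction hy using Submodule.iSup_induction' with
        | zero => rw [mul_zero]; exact Submodule.zero_mem _
        | add y y' _ _ h h' => rw [mul_add]; exact Submodule.add_mem _ h h'
        | mem j y hy => exact Submodule.mem_iSup_of_mem (i + j) (SetLike.mul_mem_graded hx hy))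

theorem mem_Pol {a : A} : a ∈ S.Pol ↔ a ∈ ⨆ k : ℤ, S.homog k := Iff.rfl

/-- The inclusion of the homogeneous elements of degree `k` in the polynomial elements. -/
def incl (k : ℤ) : S.homog k →ₗ[ℂ] S.Pol where
  toFun a := ⟨a, Submodule.mem_iSup_of_mem k a.2⟩
  map_add' _ _ := rfl
  map_smul' _ _ := rfl

theorem sumIncl_bijective :
    Function.Bijective (DirectSum.toModule ℂ ℤ S.Pol S.incl) := by
  have hcomp : S.Pol.val.toLinearMap ∘ₗ DirectSum.toModule ℂ ℤ S.Pol S.incl =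
      DirectSum.coeLinearMap S.homog := by
    ext k a
    simp [incl]
  constructor
  · have hind : iSupIndep S.homog :=
      (Module.End.eigenspaces_iSupIndep S.derivA).comp Int.cast_injective
    have hinj := hind.dfinsupp_lsum_injective
    have h2 : Function.Injective
        (S.Pol.val.toLinearMap ∘ₗ DirectSum.toModule ℂ ℤ S.Pol S.incl) := by
      rw [hcomp]; exact hinj
    rw [LinearMap.coe_comp] at h2
    exact h2.of_comp
  · rintro ⟨a, ha⟩
    rw [mem_Pol, ← DirectSum.range_coeLinearMap, ← hcomp] at ha
    obtain ⟨x, hx⟩ := ha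
    exact ⟨x, Subtype.ext hx⟩

/-- The decomposition of the algebra of polynomial elements by degree. -/
def decomp : (⨁ k : ℤ, S.homog k) ≃ₗ[ℂ] S.Pol :=
  LinearEquiv.ofBijective (DirectSum.toModule ℂ ℤ S.Pol S.incl) S.sumIncl_bijective

theorem decomp_of (k : ℤ) (a : S.homog k) :
    S.decomp (DirectSum.of (fun k => S.homog k) k a) = S.incl k a := by
  rw [← DirectSum.lof_eq_of ℂ, decomp, LinearEquiv.ofBijective_apply, DirectSum.toModule_lof]

/-- The coaction, `a ↦ a ⊗ zᵏ` for `a` of degree `k`. -/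
def coaction : S.Pol →ₗ[ℂ] S.Pol ⊗[ℂ] LaurentPolynomial ℂ :=
  (DirectSum.toModule ℂ ℤ (S.Pol ⊗[ℂ] LaurentPolynomial ℂ) fun k =>
    ((TensorProduct.mk ℂ S.Pol (LaurentPolynomial ℂ)).flip (LaurentPolynomial.T k)).comp
      (S.incl k)).comp S.decomp.symm.toLinearMap

/-- The map `a' ⊗ a ↦ a' a₍₀₎ ⊗ a₍₁₎` on the tensor product over the complex numbers. -/
def preCanonicalMap : S.Pol ⊗[ℂ] S.Pol →ₗ[ℂ] S.Pol ⊗[ℂ] LaurentPolynomial ℂ :=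
  TensorProduct.lift ((LinearMap.mul ℂ (S.Pol ⊗[ℂ] LaurentPolynomial ℂ)).compl₁₂
    ((TensorProduct.mk ℂ S.Pol (LaurentPolynomial ℂ)).flip 1) S.coaction)

/-- The subspace by which `Pol ⊗ Pol` has to be divided to get the tensor product over `B`. -/
def balanced : Submodule ℂ (S.Pol ⊗[ℂ] S.Pol) :=
  Submodule.span ℂ {t | ∃ (x y : S.Pol) (b : S.homog 0),
    t = (x * S.incl 0 b) ⊗ₜ[ℂ] y - x ⊗ₜ[ℂ] (S.incl 0 b * y)}

theorem coaction_incl (k : ℤ) (a : S.homog k) :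
    S.coaction (S.incl k a) = S.incl k a ⊗ₜ[ℂ] LaurentPolynomial.T k := by
  have h : S.decomp.symm (S.incl k a) = DirectSum.lof ℂ ℤ (fun k => S.homog k) k a := by
    rw [LinearEquiv.symm_apply_eq, DirectSum.lof_eq_of, decomp_of]
  simp [coaction, h, DirectSum.toModule_lof]

theorem coaction_zero_mul (b : S.homog 0) (y : S.Pol) :
    S.coaction (S.incl 0 b * y) =
      (S.incl 0 b ⊗ₜ[ℂ] (1 : LaurentPolynomial ℂ)) * S.coaction y := by
  obtain ⟨x, rfl⟩ := S.decomp.surjective y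
  induction x using DirectSum.induction_on with
  | zero => simp
  | add x y hx hy => rw [map_add, mul_add, map_add, hx, hy, map_add, mul_add]
  | of k a =>
    have h2 : S.incl 0 b * S.incl k a =
        S.incl k ⟨(b : A) * a, by simpa using SetLike.mul_mem_graded b.2 a.2⟩ := rfl
    rw [decomp_of, coaction_incl, Algebra.TensorProduct.tmul_mul_tmul, one_mul, h2, coaction_incl]

theorem balanced_le_ker : S.balanced ≤ LinearMap.ker S.preCanonicalMap := by
  rw [balanced, Submodule.span_le]
  rintro t ⟨x, y, b, rfl⟩
  rw [SetLike.mem_coe, LinearMap.mem_ker, map_sub, sub_eq_zero]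
  simp only [preCanonicalMap, TensorProduct.lift.tmul, LinearMap.compl₁₂_apply,
    LinearMap.flip_apply, TensorProduct.mk_apply, LinearMap.mul_apply']
  rw [coaction_zero_mul, ← mul_assoc, Algebra.TensorProduct.tmul_mul_tmul, one_mul]

/-- The canonical map `χ : A ⊗_B A → A ⊗ ℂ[z, z⁻¹]`, `a' ⊗ a ↦ a' a₍₀₎ ⊗ a₍₁₎`. -/
def canonicalMap :
    ((S.Pol ⊗[ℂ] S.Pol) ⧸ S.balanced) →ₗ[ℂ] S.Pol ⊗[ℂ] LaurentPolynomial ℂ :=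
  S.balanced.liftQ S.preCanonicalMap S.balanced_le_ker

/-- `B ⊆ A` is a `U(1)` Hopf–Galois extension (a noncommutative principal `U(1)`-bundle). -/
def IsHopfGalois : Prop := Function.Bijective S.canonicalMap

end HopfGalois

section Bundle

/-- The selfadjoint generator `δ` of the `U(1)`-action on the Hilbert space. -/
def delta : H →ₗ.[ℂ] H := generator S.U

/-- The eigenspace `H_k` of `δ`. -/
def Hk (k : ℤ) : Submodule ℂ H := eigenspace S.delta (k : ℂ)

/-- `[D, a]`, as a bounded operator. -/
def dD (a : A) : H →L[ℂ] H := boundedCommutator S.D (S.rep a)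

/-- The one-forms `∑ pᵢ [D, qᵢ]` with coefficients in a subspace of the algebra. -/
def oneForms (B : Submodule ℂ A) : Submodule ℂ (H →L[ℂ] H) :=
  Submodule.span ℂ {η | ∃ p ∈ B, ∃ q ∈ B, η = S.rep p * S.dD q}

/-- The horizontal Dirac operator `D_h = ½ Γ [Γ, D]`, on its natural domain. -/
def horizontalDirac (Γ : H →L[ℂ] H) : H →ₗ.[ℂ] H where
  domain := S.D.domain ⊓ S.D.domain.comap (Γ : H →ₗ[ℂ] H)
  toFun :=
    { toFun := fun x => (1 / 2 : ℂ) • Γ (Γ (S.D ⟨x, x.2.1⟩) - S.D ⟨Γ x, x.2.2⟩)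
      map_add' := by
        rintro ⟨x, hx⟩ ⟨y, hy⟩
        have h1 : S.D ⟨x + y, S.D.domain.add_mem hx.1 hy.1⟩ = S.D ⟨x, hx.1⟩ + S.D ⟨y, hy.1⟩ :=
          S.D.map_add ⟨x, hx.1⟩ ⟨y, hy.1⟩
        have h2 : S.D ⟨Γ (x + y), by rw [map_add]; exact S.D.domain.add_mem hx.2 hy.2⟩
            = S.D ⟨Γ x, hx.2⟩ + S.D ⟨Γ y, hy.2⟩ := by
          rw [← S.D.map_add]; congr 1; ext; simp
        simp only [Submodule.coe_add]
        rw [h1, h2]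
        simp only [map_add, map_sub, smul_add, smul_sub]
        abel
      map_smul' := by
        rintro c ⟨x, hx⟩
        have h1 : S.D ⟨c • x, S.D.domain.smul_mem c hx.1⟩ = c • S.D ⟨x, hx.1⟩ :=
          S.D.map_smul c ⟨x, hx.1⟩
        have h2 : S.D ⟨Γ (c • x), by rw [map_smul]; exact S.D.domain.smul_mem c hx.2⟩
            = c • S.D ⟨Γ x, hx.2⟩ := by
          rw [← S.D.map_smul]; congr 1; ext; simp
        simp only [Submodule.coe_smul, RingHom.id_apply]
        rw [h1, h2]
        simp only [map_smul, ← smul_sub]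
        rw [smul_comm] }

/-- The spectral triple is projectable along the fibres, with the `ℤ/2`-grading `Γ`. That `Γ`
preserves `Dom D` is what gives the commutator `[Γ, D]` the domain of `D`. -/
structure IsProjectable (Γ : H →L[ℂ] H) : Prop where
  selfAdjoint : IsSelfAdjoint Γ
  sq : Γ * Γ = 1
  comm_rep : ∀ a, Commute Γ (S.rep a)
  anticomm_J : ∀ x, Γ (S.J x) = -S.J (Γ x)
  comm_delta : IsCommutator S.delta Γ 0
  map_domain : ∀ x ∈ S.D.domain, Γ x ∈ S.D.domain

/-- The differential calculus over `B` is projectable: `[D_h, b] = [D, b]` for `b ∈ B`. -/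
def HasProjectableCalculus (Γ : H →L[ℂ] H) : Prop :=
  ∀ b ∈ S.homog 0, IsCommutator (S.horizontalDirac Γ) (S.rep b) (S.dD b)

/-- The fibres have constant length `2π`: with `D_v = Γ δ`, the operator `D - D_h - D_v` is bounded
(with bounded extension `Z`), and `Z` commutes with all `J a* J⁻¹`. -/
structure HasConstantFibres (Γ Z : H →L[ℂ] H) : Prop where
  decomp : ∀ (x : H) (hD : x ∈ S.D.domain) (hh : x ∈ (S.horizontalDirac Γ).domain)
    (hδ : x ∈ S.delta.domain),
    S.D ⟨x, hD⟩ - S.horizontalDirac Γ ⟨x, hh⟩ - Γ (S.delta ⟨x, hδ⟩) = Z x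
  comm : ∀ a, Commute Z (antiConj S.J (S.rep (star a)))

/-- The calculus given by `D` is compatible with the de Rham calculus over `U(1)`:
`∑ pᵢ [D, qᵢ] = 0` implies `∑ pᵢ δ(qᵢ) = 0`. -/
def HasCompatibleCalculus : Prop :=
  ∀ (n : ℕ) (p q : Fin n → A), ∑ i, S.rep (p i) * S.dD (q i) = 0 →
    ∑ i, S.rep (p i * S.derivA (q i)) = 0

/-- `ω` is a strong principal connection for the bundle. -/
structure IsStrongConnection (ω : H →L[ℂ] H) : Prop where
  mem : ω ∈ S.oneForms ⊤
  invariant : IsCommutator S.delta ω 0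
  vertical : ∀ (n : ℕ) (p q : Fin n → A), ω = ∑ i, S.rep (p i) * S.dD (q i) →
    ∑ i, S.rep (p i * S.derivA (q i)) = 1
  strong : ∀ a, S.dD a - S.rep (S.derivA a) * ω ∈
    Submodule.span ℂ {T | ∃ η ∈ S.oneForms (S.homog 0), ∃ c : A, T = η * S.rep c}

end Bundle

section Twist

/-- The right action `h ↦ h p := J p* J⁻¹ h` of an element `p` of the algebra. -/
def rightAct (p : A) : H →L[ℂ] H := antiConj S.J (S.rep (star p))

/-- The right action `h ↦ h η := -J η* J⁻¹ h` of a one-form `η`. -/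
def rightForm (η : H →L[ℂ] H) : H →L[ℂ] H := -antiConj S.J (ContinuousLinearMap.adjoint η)

/-- The connection `∇_ω(p) = [D, p] - k p ω` for `p` of degree `k`. -/
def nabla (ω : H →L[ℂ] H) (k : ℤ) (p : A) : H →L[ℂ] H :=
  S.dD p - (k : ℂ) • (S.rep p * ω)

/-- The operator `D_0`, the restriction of `D_h` to `H_0`. -/
def dirac0 (Γ : H →L[ℂ] H) : H →ₗ.[ℂ] H := (S.horizontalDirac Γ).domRestrict (S.Hk 0)

/-- The graph of the twist of `D_0` by `A⁽ᵏ⁾`: it is spanned by the pairs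
`(h p, (D_0 h) p + h ∇_ω(p))` with `h ∈ Dom D_0` and `p ∈ A⁽ᵏ⁾`. -/
def twistGraph (Γ ω : H →L[ℂ] H) (k : ℤ) : Submodule ℂ (H × H) :=
  Submodule.span ℂ {v | ∃ (h : (S.dirac0 Γ).domain), ∃ p ∈ S.homog k,
    v = (S.rightAct p h,
      S.rightAct p (S.dirac0 Γ h) + S.rightForm (S.nabla ω k p) h)}

/-- The twisted Dirac operator on `H_k`: the closure of the twist of `D_0` by `A⁽ᵏ⁾`. -/
def twistedDiracOn (Γ ω : H →L[ℂ] H) (k : ℤ) : H →ₗ.[ℂ] H :=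
  (S.twistGraph Γ ω k).toLinearPMap.closure

/-- The graph of the algebraic direct sum over `k` of the operators on the spaces `H_k`. -/
def directSumGraph (Γ ω : H →L[ℂ] H) : Submodule ℂ (H × H) :=
  ⨆ k : ℤ, (S.twistedDiracOn Γ ω k).graph

/-- The twisted Dirac operator `D_ω`: the closure of the direct sum of the operators on `H_k`. -/
def twistedDirac (Γ ω : H →L[ℂ] H) : H →ₗ.[ℂ] H :=
  (S.directSumGraph Γ ω).toLinearPMap.closure

/-- The operator `D + J ω* J⁻¹ δ - Z` on its natural domain `Dom D ∩ Dom δ`. -/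
def twistFormula (Z ω : H →L[ℂ] H) : H →ₗ.[ℂ] H :=
  S.D + ((antiConj S.J (ContinuousLinearMap.adjoint ω) : H →L[ℂ] H) : H →ₗ[ℂ] H).compPMap S.delta
    - (Z : H →ₗ[ℂ] H).toPMap ⊤

end Twist

end EquivariantRealSpectralTriple

end TwistedDirac

end

noncomputable section

open MeasureTheory AddCircle

/-! ### Fourier coefficients of continuous Banach-space valued functions on the circle. -/

section FourierCoefficients

/-! Write `W = J ω* J⁻¹` and let `P_k` be the projection onto `H_k`. On `H_0` the generator
vanishes, so `D_0 = D - Z`. Since `J` commutes with `D`, the Leibniz rule `D(hp) = (Dh)p + h[D, p]`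
holds for the right action, and `Z` commutes with that action; hence `(D_0 h)p + h ∇_ω(p) = (D + kW
- Z)(hp)`, which depends on `hp` alone. So the twist by `A⁽ᵏ⁾` is contained in the restriction of `D
+ Wδ - Z` to `H_k`, a bounded perturbation of a closed operator. The containment is an equality
already before closure (`twistGraph_eq`): the Hopf–Galois property gives `1 = ∑ pᵢ qᵢ` with `pᵢ` of
degree `-k` and `qᵢ` of degree `k` (`one_mem_span_of_isHopfGalois`), and then `x = ∑ (x pᵢ) qᵢ` with
each `x pᵢ` in `Dom D ∩ H_0`.

The passage from the `H_k` to `H` is Fourier analysis: a pair of vectors lies in a closed subspace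
of `H × H` as soon as all its components do (`pair_mem_of_weightProj_mem`). As `D`, `Z` and `W`
commute with the circle, `P_k` maps the closure of the graph of `D + Wδ - Z` into its closed
restriction to `H_k`. This yields closability and `D_ω = closure (D + Wδ - Z)`; the same
decomposition applied to the adjoint gives selfadjointness. The inclusion `Dom D ⊆ Dom δ` comes from
solving `Z = ½(D + ΓDΓ) - Γδ` for `δ`. Commutators are bounded because the order conditions make `W`
commute with the algebra. -/

theorem integrable_of_continuous_addCircle {E : Type*} [NormedAddCommGroup E]
    {f : UnitAddCircle → E} (hf : Continuous f) : Integrable f haarAddCircle :=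
  hf.integrable_of_hasCompactSupport (HasCompactSupport.of_compactSpace f)

variable {E F : Type*} [NormedAddCommGroup E] [NormedSpace ℂ E] [CompleteSpace E]
  [NormedAddCommGroup F] [NormedSpace ℂ F] [CompleteSpace F]

theorem ContinuousLinearMap.map_fourierCoeff (L : E →L[ℂ] F) {f : UnitAddCircle → E}
    (hf : Continuous f) (k : ℤ) :
    L (fourierCoeff f k) = fourierCoeff (fun t => L (f t)) k := by
  unfold fourierCoeff
  rw [← L.integral_comp_comm]
  · simp
  · exact integrable_of_continuous_addCircle ((fourier (-k)).continuous.smul hf)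

theorem fourierCoeff_prodMk {f : UnitAddCircle → E} {g : UnitAddCircle → F} (hf : Continuous f)
    (hg : Continuous g) (k : ℤ) :
    fourierCoeff (fun t => (f t, g t)) k = (fourierCoeff f k, fourierCoeff g k) :=
  Prod.ext ((ContinuousLinearMap.fst ℂ E F).map_fourierCoeff (hf.prodMk hg) k)
    ((ContinuousLinearMap.snd ℂ E F).map_fourierCoeff (hf.prodMk hg) k)

/-- Continuous functionals separate points and commute with taking coefficients. For a scalar
function, vanishing coefficients are summable, so the function is the sum of its Fourier series. -/
theorem eq_zero_of_fourierCoeff_eq_zero {f : UnitAddCircle → E} (hf : Continuous f)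
    (h : ∀ k, fourierCoeff f k = 0) (t : UnitAddCircle) : f t = 0 := by
  refine (SeparatingDual.eq_zero_iff_forall_dual_eq_zero (R := ℂ) _).2 fun L => ?_
  let g : C(UnitAddCircle, ℂ) := ⟨fun s => L (f s), L.continuous.comp hf⟩
  have hg : fourierCoeff g = 0 := by
    funext k
    change fourierCoeff (fun s => L (f s)) k = 0
    rw [← L.map_fourierCoeff hf, h, map_zero]
  have hs := has_pointwise_sum_fourier_series_of_summable (f := g) (by rw [hg]; exact summable_zero) t
  rw [hg] at hs
  simp only [Pi.zero_apply, zero_smul] at hs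
  exact hs.unique hasSum_zero

theorem fourierCoeff_mem_of_forall_mem {f : UnitAddCircle → E} (hf : Continuous f)
    {K : Submodule ℂ E} (hK : IsClosed (K : Set E)) (h : ∀ t, f t ∈ K) (k : ℤ) :
    fourierCoeff f k ∈ K := by
  rw [← Submodule.Quotient.mk_eq_zero]
  change K.mkQL (fourierCoeff f k) = 0
  rw [K.mkQL.map_fourierCoeff hf]
  have : (fun t => K.mkQL (f t)) = 0 := by
    funext t
    exact (Submodule.Quotient.mk_eq_zero K).2 (h t)
  rw [this]
  simp [fourierCoeff]

/-- The quotient by a closed subspace is again a Banach space, so this is uniqueness of Fourier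
coefficients there. -/
theorem mem_of_forall_fourierCoeff_mem {f : UnitAddCircle → E} (hf : Continuous f)
    {K : Submodule ℂ E} (hK : IsClosed (K : Set E)) (h : ∀ k, fourierCoeff f k ∈ K)
    (t : UnitAddCircle) : f t ∈ K := by
  rw [← Submodule.Quotient.mk_eq_zero]
  refine eq_zero_of_fourierCoeff_eq_zero (f := fun s => K.mkQL (f s))
    (K.mkQL.continuous.comp hf) (fun k => ?_) t
  rw [← K.mkQL.map_fourierCoeff hf]
  exact (Submodule.Quotient.mk_eq_zero K).2 (h k)

end FourierCoefficients

theorem exists_toCircle_eq (z : Circle) : ∃ t : UnitAddCircle, t.toCircle = z := by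
  refine ⟨((z : ℂ).arg / (2 * Real.pi) : ℝ), ?_⟩
  rw [toCircle_apply_mk]
  convert Circle.exp_arg z using 2
  field_simp

namespace TwistedDirac

section Representation

variable {H : Type*} [NormedAddCommGroup H] [InnerProductSpace ℂ H] [CompleteSpace H]

/-! ### Isotypic projections of a strongly continuous unitary representation of `U(1)`. -/

section UnitaryRep

theorem unitary_mul_apply {H : Type*} [NormedAddCommGroup H] [InnerProductSpace ℂ H]
    (U : Circle →* (H ≃ₗᵢ[ℂ] H)) (z w : Circle) (x : H) : U (z * w) x = U z (U w x) := by
  rw [map_mul]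
  rfl

variable {U : Circle →* (H ≃ₗᵢ[ℂ] H)} (hU : ∀ x, Continuous fun z => U z x)

omit [CompleteSpace H] in
theorem continuous_orbit (hU : ∀ x, Continuous fun z => U z x) (x : H) : Continuous fun t : UnitAddCircle => U t.toCircle x :=
  (hU x).comp continuous_toCircle

/-- The spectral projection onto the isotypic component of weight `k` of a strongly continuous
unitary representation of `U(1)`. -/
def weightProj (hU : ∀ x, Continuous fun z => U z x) (k : ℤ) : H →L[ℂ] H :=
  LinearMap.mkContinuous
    { toFun := fun x => fourierCoeff (fun t : UnitAddCircle => U t.toCircle x) k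
      map_add' := fun x y => by
        rw [← Pi.add_apply, ← fourierCoeff.add (integrable_of_continuous_addCircle (continuous_orbit hU x))
          (integrable_of_continuous_addCircle (continuous_orbit hU y))]
        simp only [map_add]
        rfl
      map_smul' := fun c x => by
        rw [RingHom.id_apply, ← fourierCoeff.const_smul]
        simp only [map_smul]
        rfl } 1 fun x => by
    rw [one_mul]
    refine (norm_integral_le_of_norm_le_const (C := ‖x‖) ?_).trans (by simp)
    refine Filter.Eventually.of_forall fun t => ?_
    simp [norm_smul, Circle.norm_coe]

omit [CompleteSpace H] in
theorem weightProj_apply (k : ℤ) (x : H) :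
    weightProj hU k x = fourierCoeff (fun t : UnitAddCircle => U t.toCircle x) k := rfl

theorem mem_of_weightProj_mem {E : Type*} [NormedAddCommGroup E] [NormedSpace ℂ E]
    [CompleteSpace E] {K : Submodule ℂ E} (hK : IsClosed (K : Set E)) (L : H →L[ℂ] E) {x : H}
    (h : ∀ k, L (weightProj hU k x) ∈ K) : L x ∈ K := by
  have := mem_of_forall_fourierCoeff_mem (f := fun t : UnitAddCircle => L (U t.toCircle x))
    (L.continuous.comp (continuous_orbit hU x)) hK (fun k => ?_) 0
  · simpa using this
  · rw [← L.map_fourierCoeff (continuous_orbit hU x)]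
    exact h k

/-- The version of `mem_of_weightProj_mem` for pairs of vectors. -/
theorem pair_mem_of_weightProj_mem {K : Submodule ℂ (H × H)} (hK : IsClosed (K : Set (H × H)))
    {x y : H} (h : ∀ k, (weightProj hU k x, weightProj hU k y) ∈ K) : (x, y) ∈ K := by
  have hx := continuous_orbit hU x
  have hy := continuous_orbit hU y
  have := mem_of_forall_fourierCoeff_mem (hx.prodMk hy) hK (fun k => ?_) 0
  · simpa using this
  · rw [fourierCoeff_prodMk hx hy]
    exact h k

/-- The projected pair is an average of the orbit against a character. With `K` the graph of a
closed equivariant operator, this says that the operator commutes with the projections. -/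
theorem weightProj_pair_mem {K : Submodule ℂ (H × H)} (hK : IsClosed (K : Set (H × H)))
    {x y : H} (h : ∀ z, (U z x, U z y) ∈ K) (k : ℤ) :
    (weightProj hU k x, weightProj hU k y) ∈ K := by
  have hx := continuous_orbit hU x
  have hy := continuous_orbit hU y
  rw [weightProj_apply, weightProj_apply, ← fourierCoeff_prodMk hx hy]
  exact fourierCoeff_mem_of_forall_mem (hx.prodMk hy) hK (fun t => h _) k

theorem eq_of_weightProj_eq {x y : H} (h : ∀ k, weightProj hU k x = weightProj hU k y) :
    x = y := by
  have := mem_of_weightProj_mem hU (K := ⊥) isClosed_singleton (.id ℂ H) (x := x - y)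
    (fun k => by simp [h])
  simpa [sub_eq_zero] using this

/-- Translation invariance of Haar measure: shifting the integration variable changes the character
by a scalar. -/
theorem unitary_weightProj (k : ℤ) (z : Circle) (x : H) :
    U z (weightProj hU k x) = (z : ℂ) ^ k • weightProj hU k x := by
  obtain ⟨s, rfl⟩ := exists_toCircle_eq z
  have h := (U s.toCircle).toContinuousLinearEquiv.toContinuousLinearMap.map_fourierCoeff
    (continuous_orbit hU x) k
  refine h.trans ?_
  rw [weightProj_apply]
  unfold fourierCoeff
  rw [← integral_smul, ← integral_add_right_eq_self
    (fun t => (toCircle s : ℂ) ^ k • fourier (-k) t • U t.toCircle x) s]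
  refine integral_congr_ae (Filter.Eventually.of_forall fun t => ?_)
  have h1 : (toCircle s : ℂ) ^ k * fourier (-k) (t + s) = fourier (-k) t := by
    simp only [fourier_apply, toCircle_zsmul, toCircle_add, mul_zpow, Circle.coe_mul,
      Circle.coe_zpow]
    rw [mul_left_comm, ← zpow_add₀ (Circle.coe_ne_zero _)]
    simp
  simp only [smul_smul]
  rw [h1, add_comm t s, toCircle_add, map_mul]
  rfl

theorem weightProj_comm {T : H →L[ℂ] H} (hT : ∀ z x, T (U z x) = U z (T x)) (k : ℤ) (x : H) :
    T (weightProj hU k x) = weightProj hU k (T x) := by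
  rw [weightProj_apply, T.map_fourierCoeff (continuous_orbit hU x)]
  simp only [hT]
  rfl

theorem weightProj_unitary (k : ℤ) (z : Circle) (x : H) :
    weightProj hU k (U z x) = (z : ℂ) ^ k • weightProj hU k x := by
  rw [← unitary_weightProj]
  refine (weightProj_comm hU (T := (U z).toContinuousLinearEquiv.toContinuousLinearMap)
    (fun w y => ?_) k x).symm
  change U z (U w y) = U w (U z y)
  rw [← unitary_mul_apply, mul_comm, unitary_mul_apply]

/-- The substitution `t ↦ -t` in the Haar integral turns `U` into its adjoint and conjugates the
character. -/
theorem inner_weightProj (k : ℤ) (x y : H) :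
    inner ℂ (weightProj hU k x) y = inner ℂ x (weightProj hU k y) := by
  have h1 := (innerSL ℂ x).map_fourierCoeff (continuous_orbit hU y) k
  have h2 := (innerSL ℂ y).map_fourierCoeff (continuous_orbit hU x) k
  simp only [innerSL_apply_apply, ← weightProj_apply hU] at h1 h2
  rw [h1, ← inner_conj_symm, h2]
  unfold fourierCoeff
  rw [← integral_conj, ← integral_neg_eq_self]
  refine integral_congr_ae (Filter.Eventually.of_forall fun t => ?_)
  have h3 : inner ℂ (U (toCircle (-t)) x) y = inner ℂ x (U t.toCircle y) := by
    rw [← (U t.toCircle).inner_map_map (U (toCircle (-t)) x) y, toCircle_neg]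
    congr 1
    rw [← unitary_mul_apply, mul_inv_cancel, map_one]
    rfl
  simp only [smul_eq_mul, map_mul, inner_conj_symm]
  rw [h3]
  congr 1
  rw [← fourier_neg, neg_neg]
  simp [fourier_apply]

/-- Bounded operators agree if they do on a dense set of vectors in each isotypic component. -/
theorem ext_weightProj {E : Type*} [NormedAddCommGroup E] [NormedSpace ℂ E] [CompleteSpace E]
    {A B : H →L[ℂ] E} {s : Set H} (hs : Dense s)
    (h : ∀ k, ∀ x ∈ s, A (weightProj hU k x) = B (weightProj hU k x)) : A = B := by
  ext x
  have h' : ∀ k x, A (weightProj hU k x) = B (weightProj hU k x) := fun k =>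
    congr_fun ((A.continuous.comp (weightProj hU k).continuous).ext_on hs
      (B.continuous.comp (weightProj hU k).continuous) (h k))
  have := mem_of_weightProj_mem hU (K := ⊥) isClosed_singleton (A - B) (x := x)
    (fun k => by simp [h'])
  simpa [sub_eq_zero] using this

end UnitaryRep

/-! ### The generator in terms of isotypic components. -/

section Generator

theorem mem_graph_generator {H : Type*} [NormedAddCommGroup H] [InnerProductSpace ℂ H]
    {U : Circle →* (H ≃ₗᵢ[ℂ] H)} {x y : H} : (x, y) ∈ (generator U).graph ↔
      HasDerivAt (fun t : ℝ => U (Circle.exp t) x) (Complex.I • y) 0 := by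
  rw [LinearPMap.mem_graph_iff]
  constructor
  · rintro ⟨⟨x', hx⟩, rfl, rfl⟩
    have hx' : DifferentiableAt ℝ (fun t : ℝ => U (Circle.exp t) x') 0 := hx
    convert hx'.hasDerivAt using 1
    change Complex.I • -Complex.I • deriv (fun t : ℝ => U (Circle.exp t) x') 0 = _
    rw [smul_smul]
    simp
  · intro h
    refine ⟨⟨x, h.differentiableAt⟩, rfl, ?_⟩
    change -Complex.I • deriv (fun t : ℝ => U (Circle.exp t) x) 0 = y
    rw [h.deriv, smul_smul]
    simp

theorem mem_eigenspace_iff_graph {H : Type*} [NormedAddCommGroup H] [InnerProductSpace ℂ H]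
    {T : H →ₗ.[ℂ] H} {c : ℂ} {x : H} : x ∈ eigenspace T c ↔ (x, c • x) ∈ T.graph := by
  rw [LinearPMap.mem_graph_iff]
  constructor
  · rintro ⟨h, e⟩
    exact ⟨⟨x, h⟩, rfl, e⟩
  · rintro ⟨⟨x', h⟩, rfl, e⟩
    exact ⟨h, e⟩

theorem hasDerivAt_exp_zpow_smul {E : Type*} [NormedAddCommGroup E] [NormedSpace ℂ E] (k : ℤ)
    (v : E) (t : ℝ) :
    HasDerivAt (fun t : ℝ => (Circle.exp t : ℂ) ^ k • v)
      (Complex.I • (Circle.exp t : ℂ) ^ k • (k : ℂ) • v) t := by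
  have h1 : HasDerivAt (fun t : ℝ => (Circle.exp t : ℂ)) ((Circle.exp t : ℂ) * Complex.I) t := by
    simp only [Circle.coe_exp]
    simpa using ((Complex.ofRealCLM.hasDerivAt (x := t)).mul_const Complex.I).cexp
  have h2 := ((hasDerivAt_zpow k (Circle.exp t : ℂ) (Or.inl (Circle.coe_ne_zero _))).comp t
    h1).smul_const v
  convert h2 using 1
  · rfl
  simp only [smul_smul]
  congr 1
  rw [zpow_sub_one₀ (Circle.coe_ne_zero _)]
  have := inv_mul_cancel₀ (Circle.coe_ne_zero (Circle.exp t))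
  linear_combination -(k : ℂ) * Complex.I * (Circle.exp t : ℂ) ^ k * this

variable {U : Circle →* (H ≃ₗᵢ[ℂ] H)} (hU : ∀ x, Continuous fun z => U z x)

theorem mem_eigenspace_of_forall_eq {H : Type*} [NormedAddCommGroup H] [InnerProductSpace ℂ H]
    {U : Circle →* (H ≃ₗᵢ[ℂ] H)} {k : ℤ} {x : H} (h : ∀ z, U z x = (z : ℂ) ^ k • x) :
    x ∈ eigenspace (generator U) (k : ℂ) := by
  rw [mem_eigenspace_iff_graph, mem_graph_generator]
  simp only [h]
  simpa using hasDerivAt_exp_zpow_smul k x 0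

theorem weightProj_mem_eigenspace (k : ℤ) (x : H) :
    weightProj hU k x ∈ eigenspace (generator U) (k : ℂ) :=
  mem_eigenspace_of_forall_eq fun z => unitary_weightProj hU k z x

/-- The generator in the Fourier picture. -/
theorem mem_graph_generator_iff {x y : H} : (x, y) ∈ (generator U).graph ↔
    ∀ k : ℤ, weightProj hU k y = (k : ℂ) • weightProj hU k x := by
  rw [mem_graph_generator]
  constructor
  · intro h k
    have h1 := ((weightProj hU k).restrictScalars ℝ).hasFDerivAt.comp_hasDerivAt 0 h
    have h2 := hasDerivAt_exp_zpow_smul k (weightProj hU k x) 0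
    have h3 : ((weightProj hU k).restrictScalars ℝ) ∘ (fun t : ℝ => U (Circle.exp t) x) =
        fun t : ℝ => (Circle.exp t : ℂ) ^ k • weightProj hU k x := by
      funext t
      exact weightProj_unitary hU k _ x
    rw [h3] at h1
    have h4 := h1.unique h2
    simpa using h4
  · intro h
    have hc : Continuous fun s : ℝ => Complex.I • U (Circle.exp s) y :=
      ((hU y).comp Circle.exp.continuous).const_smul _
    -- The orbit is the integral of its expected derivative, as one checks on each weight component,
    -- where it is the fundamental theorem of calculus for `exp(ikt)`. Differentiability at `0` is
    -- then read off the integral.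
    have key : (fun t : ℝ => U (Circle.exp t) x) =
        fun t : ℝ => x + ∫ s in (0 : ℝ)..t, Complex.I • U (Circle.exp s) y := by
      funext t
      refine eq_of_weightProj_eq hU fun k => ?_
      rw [map_add, weightProj_unitary,
        ← (weightProj hU k).intervalIntegral_comp_comm (hc.intervalIntegrable _ _)]
      simp only [map_smul, weightProj_unitary, h]
      rw [intervalIntegral.integral_eq_sub_of_hasDerivAt
        (fun s _ => hasDerivAt_exp_zpow_smul k (weightProj hU k x) s)]
      · simp
      · refine Continuous.intervalIntegrable ?_ _ _
        refine Continuous.const_smul (Continuous.smul ?_ continuous_const) _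
        exact (continuous_subtype_val.comp Circle.exp.continuous).zpow₀ _
          fun s => Or.inl (Circle.coe_ne_zero _)
    rw [key]
    have := (hc.integral_hasStrictDerivAt 0 0).hasDerivAt.const_add x
    simpa using this

theorem weightProj_of_mem_eigenspace {k j : ℤ} {x : H}
    (hx : x ∈ eigenspace (generator U) (k : ℂ)) (hjk : j ≠ k) : weightProj hU j x = 0 := by
  rw [mem_eigenspace_iff_graph, mem_graph_generator_iff hU] at hx
  have h := hx j
  rw [map_smul, ← sub_eq_zero, ← sub_smul] at h
  refine (smul_eq_zero.1 h).resolve_left (sub_ne_zero.2 ?_)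
  exact_mod_cast hjk.symm

include hU in
theorem mem_eigenspace_iff {k : ℤ} {x : H} : x ∈ eigenspace (generator U) (k : ℂ) ↔
    ∀ z, U z x = (z : ℂ) ^ k • x := by
  refine ⟨fun hx z => eq_of_weightProj_eq hU fun j => ?_, mem_eigenspace_of_forall_eq⟩
  rw [weightProj_unitary, map_smul]
  by_cases hj : j = k
  · rw [hj]
  · rw [weightProj_of_mem_eigenspace hU hx hj, smul_zero, smul_zero]

include hU in
/-- A bounded operator that commutes with the generator commutes with the representation. -/
theorem commutes_of_isCommutator_generator {T : H →L[ℂ] H}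
    (hT : IsCommutator (generator U) T 0) (z : Circle) (x : H) : T (U z x) = U z (T x) := by
  -- `T` preserves each eigenspace, and there `U z` is the scalar `z ^ k`.
  have hT' : ∀ (k : ℤ) (y : H), y ∈ eigenspace (generator U) (k : ℂ) →
      T y ∈ eigenspace (generator U) (k : ℂ) := by
    rintro k y ⟨hy, ey⟩
    obtain ⟨h, e⟩ := hT ⟨y, hy⟩
    refine ⟨h, ?_⟩
    rw [ey, map_smul] at e
    simpa [sub_eq_zero] using e
  have := ext_weightProj hU (s := Set.univ) dense_univ
    (A := T ∘L (U z).toContinuousLinearEquiv.toContinuousLinearMap)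
    (B := (U z).toContinuousLinearEquiv.toContinuousLinearMap ∘L T) fun k y _ => ?_
  · exact congr_arg (fun A : H →L[ℂ] H => A x) this
  · change T (U z (weightProj hU k y)) = U z (T (weightProj hU k y))
    have hy := weightProj_mem_eigenspace hU k y
    rw [(mem_eigenspace_iff hU).1 hy, (mem_eigenspace_iff hU).1 (hT' k _ hy), map_smul]

end Generator

end Representation

theorem adjoint_comm_unitary {H : Type*} [NormedAddCommGroup H] [InnerProductSpace ℂ H]
    [CompleteSpace H] {U : Circle →* (H ≃ₗᵢ[ℂ] H)} {T : H →L[ℂ] H}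
    (hT : ∀ z x, T (U z x) = U z (T x)) (z : Circle) (x : H) :
    ContinuousLinearMap.adjoint T (U z x) = U z (ContinuousLinearMap.adjoint T x) := by
  have h (w : H) : U z (U z⁻¹ w) = w := by
    rw [← unitary_mul_apply, mul_inv_cancel, map_one]
    rfl
  refine ext_inner_right ℂ fun v => ?_
  rw [ContinuousLinearMap.adjoint_inner_left, ← h v, hT, LinearIsometryEquiv.inner_map_map,
    LinearIsometryEquiv.inner_map_map, ContinuousLinearMap.adjoint_inner_left]

/-- In graph form the domain condition and the commutator identity are a single statement, which
passes to closures. -/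
theorem graph_of_isCommutator {H : Type*} [NormedAddCommGroup H] [InnerProductSpace ℂ H]
    {D : H →ₗ.[ℂ] H} {T C : H →L[ℂ] H} (h : IsCommutator D T C) {x y : H}
    (hx : (x, y) ∈ D.graph) : (T x, T y + C x) ∈ D.graph := by
  obtain ⟨x, rfl, rfl⟩ := D.mem_graph_iff.1 hx
  obtain ⟨h1, h2⟩ := h x
  exact D.mem_graph_iff.2 ⟨⟨_, h1⟩, rfl, by simp [← h2]⟩

theorem isCommutator_of_graph {H : Type*} [NormedAddCommGroup H] [InnerProductSpace ℂ H]
    {D : H →ₗ.[ℂ] H} {T C : H →L[ℂ] H}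
    (h : ∀ v ∈ D.graph, (T v.1, T v.2 + C v.1) ∈ D.graph) : IsCommutator D T C := by
  intro x
  obtain ⟨y, h1, h2⟩ := D.mem_graph_iff.1 (h _ (D.mem_graph x))
  change (y : H) = T x at h1
  have hy : T x ∈ D.domain := h1 ▸ y.2
  refine ⟨hy, ?_⟩
  have : y = ⟨T x, hy⟩ := Subtype.ext h1
  rw [← this, h2]
  simp

namespace EquivariantRealSpectralTriple

variable {A H : Type*} [Ring A] [StarRing A] [Algebra ℂ A] [StarModule ℂ A]
  [NormedAddCommGroup H] [InnerProductSpace ℂ H] [CompleteSpace H]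
  (S : EquivariantRealSpectralTriple A H)

/-! ### The graph of `D` and the spaces `H_k`. -/

section Basic

theorem graph_D_closed : IsClosed (S.D.graph : Set (H × H)) := S.D_selfAdjoint.isClosed

theorem dense_domain_D : Dense (S.D.domain : Set H) := S.D_selfAdjoint.dense_domain

/-- This is `D = D*`: from left to right it gives symmetry, from right to left maximality. -/
theorem mem_graph_D_iff {x y : H} : (x, y) ∈ S.D.graph ↔
    ∀ v ∈ S.D.graph, inner ℂ v.2 x = inner ℂ v.1 y := by
  conv_lhs => rw [← LinearPMap.isSelfAdjoint_def.1 S.D_selfAdjoint]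
  rw [LinearPMap.adjoint_graph_eq_graph_adjoint S.dense_domain_D, Submodule.mem_adjoint_iff]
  simp only [Prod.forall, sub_eq_zero]

theorem exists_graph_D {x : H} (hx : x ∈ S.D.domain) : ∃ y, (x, y) ∈ S.D.graph :=
  ⟨_, S.D.mem_graph ⟨x, hx⟩⟩

theorem isCommutator_dD (a : A) : IsCommutator S.D (S.rep a) (S.dD a) := by
  unfold dD boundedCommutator
  rw [dif_pos (S.D_boundedCommutator a)]
  exact (S.D_boundedCommutator a).choose_spec

theorem graph_D_rep (a : A) {x y : H} (h : (x, y) ∈ S.D.graph) :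
    (S.rep a x, S.rep a y + S.dD a x) ∈ S.D.graph :=
  graph_of_isCommutator (S.isCommutator_dD a) h

theorem graph_D_J {x y : H} (h : (x, y) ∈ S.D.graph) : (S.J x, S.J y) ∈ S.D.graph := by
  obtain ⟨x, rfl, rfl⟩ := S.D.mem_graph_iff.1 h
  obtain ⟨h1, h2⟩ := S.J_D x
  exact S.D.mem_graph_iff.2 ⟨⟨_, h1⟩, rfl, h2⟩

theorem J_symm_apply (x : H) : S.J.symm x = -S.J x := by
  rw [LinearIsometryEquiv.symm_apply_eq, map_neg, S.J_sq, neg_neg]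

theorem graph_D_J_symm {x y : H} (h : (x, y) ∈ S.D.graph) :
    (S.J.symm x, S.J.symm y) ∈ S.D.graph := by
  rw [J_symm_apply, J_symm_apply]
  exact S.D.graph.neg_mem (S.graph_D_J h)

theorem J_symm_unitary (z : Circle) (x : H) : S.J.symm (S.U z x) = S.U z (S.J.symm x) := by
  rw [J_symm_apply, J_symm_apply, S.J_equivariant, map_neg]

theorem graph_D_unitary (z : Circle) {x y : H} (h : (x, y) ∈ S.D.graph) :
    (S.U z x, S.U z y) ∈ S.D.graph := by
  obtain ⟨x, rfl, rfl⟩ := S.D.mem_graph_iff.1 h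
  obtain ⟨h1, h2⟩ := S.D_equivariant z x
  exact S.D.mem_graph_iff.2 ⟨⟨_, h1⟩, rfl, h2⟩

/-- The projection onto `H_k`. -/
def proj (k : ℤ) : H →L[ℂ] H := weightProj S.U_continuous k

theorem graph_D_proj (k : ℤ) {x y : H} (h : (x, y) ∈ S.D.graph) :
    (S.proj k x, S.proj k y) ∈ S.D.graph :=
  weightProj_pair_mem S.U_continuous S.graph_D_closed (fun z => S.graph_D_unitary z h) k

theorem proj_mem_Hk (k : ℤ) (x : H) : S.proj k x ∈ S.Hk k :=
  weightProj_mem_eigenspace S.U_continuous k x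

theorem mem_Hk_iff {k : ℤ} {x : H} : x ∈ S.Hk k ↔ ∀ z, S.U z x = (z : ℂ) ^ k • x :=
  mem_eigenspace_iff S.U_continuous

theorem graph_delta_of_mem_Hk {k : ℤ} {x : H} (hx : x ∈ S.Hk k) :
    (x, (k : ℂ) • x) ∈ S.delta.graph :=
  mem_eigenspace_iff_graph.1 hx

theorem graph_delta_iff {x y : H} : (x, y) ∈ S.delta.graph ↔
    ∀ k : ℤ, S.proj k y = (k : ℂ) • S.proj k x :=
  mem_graph_generator_iff S.U_continuous

theorem graph_delta_unique {x y y' : H} (h : (x, y) ∈ S.delta.graph)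
    (h' : (x, y') ∈ S.delta.graph) : y = y' :=
  S.delta.mem_graph_snd_inj h h' rfl

theorem proj_comm {T : H →L[ℂ] H} (hT : ∀ z x, T (S.U z x) = S.U z (T x)) (k : ℤ) (x : H) :
    T (S.proj k x) = S.proj k (T x) :=
  weightProj_comm S.U_continuous hT k x

theorem rep_mem_Hk {m k : ℤ} {a : A} (ha : a ∈ S.homog k) {x : H} (hx : x ∈ S.Hk m) :
    S.rep a x ∈ S.Hk (m + k) := by
  refine mem_eigenspace_iff_graph.2 ?_
  have h := graph_of_isCommutator (S.rep_equivariant a) (S.graph_delta_of_mem_Hk hx)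
  rw [S.mem_homog.1 ha] at h
  simp only [map_smul, smul_apply] at h
  rw [Int.cast_add, add_smul]
  exact h

theorem star_mem_homog {k : ℤ} {a : A} (ha : a ∈ S.homog k) : star a ∈ S.homog (-k) := by
  rw [mem_homog] at *
  rw [S.derivA_star, ha]
  simp

/-- `J` commutes with the circle action and is antilinear, so it conjugates the character. -/
theorem J_mem_Hk {k : ℤ} {x : H} (hx : x ∈ S.Hk k) : S.J x ∈ S.Hk (-k) := by
  rw [mem_Hk_iff] at *
  intro z
  rw [← S.J_equivariant, hx, map_smulₛₗ, zpow_neg, map_zpow₀, ← Circle.coe_inv_eq_conj,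
    Circle.coe_inv, inv_zpow]

theorem J_symm_mem_Hk {k : ℤ} {x : H} (hx : x ∈ S.Hk k) : S.J.symm x ∈ S.Hk (-k) := by
  rw [J_symm_apply]
  exact Submodule.neg_mem _ (S.J_mem_Hk hx)

end Basic

/-! ### The right action of the algebra and of one-forms. -/

section RightAction

theorem antiConj_apply {H : Type*} [NormedAddCommGroup H] [InnerProductSpace ℂ H] (J : H ≃ₗᵢ⋆[ℂ] H) (T : H →L[ℂ] H) (x : H) :
    antiConj J T x = J (T (J.symm x)) := rfl

theorem rightAct_apply (p : A) (x : H) :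
    S.rightAct p x = S.J (S.rep (star p) (S.J.symm x)) := rfl

theorem rightAct_mul (p q : A) (x : H) :
    S.rightAct (p * q) x = S.rightAct q (S.rightAct p x) := by
  simp [rightAct_apply]

theorem rightAct_one (x : H) : S.rightAct 1 x = x := by
  simp [rightAct_apply]

theorem rightAct_add (p q : A) (x : H) :
    S.rightAct (p + q) x = S.rightAct p x + S.rightAct q x := by
  simp [rightAct_apply]

theorem rightAct_smul (c : ℂ) (p : A) (x : H) :
    S.rightAct (c • p) x = c • S.rightAct p x := by
  simp [rightAct_apply, map_smulₛₗ]

theorem rightAct_mem_Hk {m k : ℤ} {p : A} (hp : p ∈ S.homog k) {x : H} (hx : x ∈ S.Hk m) :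
    S.rightAct p x ∈ S.Hk (m + k) := by
  have := S.J_mem_Hk (S.rep_mem_Hk (S.star_mem_homog hp) (S.J_symm_mem_Hk hx))
  rwa [neg_add, neg_neg, neg_neg] at this

/-- Symmetry of `D`, tested on its dense domain in both variables; both sides are bounded. -/
theorem adjoint_dD (p : A) : ContinuousLinearMap.adjoint (S.dD p) = -S.dD (star p) := by
  refine (DFunLike.coe_injective ?_)
  refine (ContinuousLinearMap.continuous _).ext_on S.dense_domain_D
    (ContinuousLinearMap.continuous _) fun x hx => ?_
  obtain ⟨x', hx'⟩ := S.exists_graph_D hx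
  refine S.dense_domain_D.eq_of_inner_right ℂ fun y hy => ?_
  obtain ⟨y', hy'⟩ := S.exists_graph_D hy
  have h1 := S.mem_graph_D_iff.1 hx' _ (S.graph_D_rep p hy')
  have h2 := S.mem_graph_D_iff.1 (S.graph_D_rep (star p) hx') _ hy'
  have h3 (u v : H) : inner ℂ u (S.rep (star p) v) = inner ℂ (S.rep p u) v := by
    rw [map_star, ContinuousLinearMap.star_eq_adjoint, ContinuousLinearMap.adjoint_inner_right]
  rw [ContinuousLinearMap.adjoint_inner_right, neg_apply, inner_neg_right]
  simp only [inner_add_left, inner_add_right, h3] at h1 h2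
  linear_combination h1 - h2

theorem rightForm_dD (p : A) (x : H) :
    S.rightForm (S.dD p) x = S.J (S.dD (star p) (S.J.symm x)) := by
  rw [rightForm, neg_apply, adjoint_dD, antiConj_apply]
  simp

/-- The Leibniz rule `D(hp) = (Dh)p + h[D, p]`, obtained by conjugating the commutator with `p*` by
`J`. -/
theorem graph_D_rightAct (p : A) {x y : H} (h : (x, y) ∈ S.D.graph) :
    (S.rightAct p x, S.rightAct p y + S.rightForm (S.dD p) x) ∈ S.D.graph := by
  have := S.graph_D_J (S.graph_D_rep (star p) (S.graph_D_J_symm h))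
  rwa [map_add, ← rightForm_dD] at this

/-- Since `h(pω) = -W(hp)`, the term `-k p ω` of the connection contributes `+kW(hp)`. -/
theorem rightForm_nabla (ω : H →L[ℂ] H) (k : ℤ) (p : A) (x : H) :
    S.rightForm (S.nabla ω k p) x = S.rightForm (S.dD p) x +
      antiConj S.J (ContinuousLinearMap.adjoint ω) ((k : ℂ) • S.rightAct p x) := by
  simp only [rightForm, nabla, neg_apply, antiConj_apply, rightAct_apply]
  rw [map_sub, ← ContinuousLinearMap.star_eq_adjoint (_ • _), star_smul, star_mul, ← map_star,
    ContinuousLinearMap.star_eq_adjoint]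
  simp [map_smulₛₗ]
  abel

end RightAction

/-! ### The operator `Z` and the inclusion `Dom D ⊆ Dom δ`. -/

section Fibres

variable {S} {Γ Z : H →L[ℂ] H}

theorem IsProjectable.comm_unitary (hΓ : S.IsProjectable Γ) (z : Circle) (x : H) :
    Γ (S.U z x) = S.U z (Γ x) :=
  commutes_of_isCommutator_generator S.U_continuous hΓ.comm_delta z x

theorem IsProjectable.apply_apply (hΓ : S.IsProjectable Γ) (x : H) : Γ (Γ x) = x :=
  congr_arg (fun T : H →L[ℂ] H => T x) hΓ.sq

theorem IsProjectable.domain_horizontalDirac (hΓ : S.IsProjectable Γ) :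
    (S.horizontalDirac Γ).domain = S.D.domain :=
  inf_eq_left.2 fun x hx => hΓ.map_domain x hx

theorem horizontalDirac_apply (hΓ : S.IsProjectable Γ) {x y y' : H} (h : (x, y) ∈ S.D.graph)
    (h' : (Γ x, y') ∈ S.D.graph) (hx : x ∈ (S.horizontalDirac Γ).domain) :
    S.horizontalDirac Γ ⟨x, hx⟩ = (1 / 2 : ℂ) • (y - Γ y') := by
  change (1 / 2 : ℂ) • Γ (Γ (S.D ⟨x, hx.1⟩) - S.D ⟨Γ x, hx.2⟩) = _
  rw [map_sub, hΓ.apply_apply, S.D.mem_graph_snd_inj h (S.D.mem_graph ⟨x, hx.1⟩) rfl,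
    S.D.mem_graph_snd_inj h' (S.D.mem_graph ⟨Γ x, hx.2⟩) rfl]

/-- From `Γ² = 1` one gets `D - D_h = ½(D + ΓDΓ)`; here `y'` stands for `DΓx`. -/
theorem HasConstantFibres.apply_eq (hΓ : S.IsProjectable Γ) (hZ : S.HasConstantFibres Γ Z)
    {x y y' d : H} (h : (x, y) ∈ S.D.graph) (h' : (Γ x, y') ∈ S.D.graph)
    (hd : (x, d) ∈ S.delta.graph) : Z x = (1 / 2 : ℂ) • (y + Γ y') - Γ d := by
  have hD := S.D.mem_domain_of_mem_graph h
  have hδ := S.delta.mem_domain_of_mem_graph hd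
  have hh : x ∈ (S.horizontalDirac Γ).domain := by rwa [hΓ.domain_horizontalDirac]
  rw [← hZ.decomp x hD hh hδ, horizontalDirac_apply hΓ h h' hh,
    S.D.mem_graph_snd_inj h (S.D.mem_graph ⟨x, hD⟩) rfl,
    S.delta.mem_graph_snd_inj hd (S.delta.mem_graph ⟨x, hδ⟩) rfl]
  module

/-- The projected vector lies in `Dom δ` even when this is not yet known for `x`. So the formula for
`Z` is available on a set large enough to show that `Z` commutes with the circle. -/
theorem HasConstantFibres.apply_proj (hΓ : S.IsProjectable Γ) (hZ : S.HasConstantFibres Γ Z)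
    {x y y' : H} (h : (x, y) ∈ S.D.graph) (h' : (Γ x, y') ∈ S.D.graph) (k : ℤ) :
    Z (S.proj k x) = S.proj k ((1 / 2 : ℂ) • (y + Γ y') - (k : ℂ) • Γ x) := by
  have hg := S.graph_D_proj k h'
  rw [← S.proj_comm hΓ.comm_unitary] at hg
  rw [hZ.apply_eq hΓ (S.graph_D_proj k h) hg (S.graph_delta_of_mem_Hk (S.proj_mem_Hk k x))]
  simp only [map_sub, map_smul, map_add, S.proj_comm hΓ.comm_unitary]

theorem HasConstantFibres.comm_unitary (hΓ : S.IsProjectable Γ)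
    (hZ : S.HasConstantFibres Γ Z) (z : Circle) (x : H) : Z (S.U z x) = S.U z (Z x) := by
  have := ext_weightProj S.U_continuous S.dense_domain_D
    (A := Z ∘L (S.U z).toContinuousLinearEquiv.toContinuousLinearMap)
    (B := (S.U z).toContinuousLinearEquiv.toContinuousLinearMap ∘L Z) fun k x hx => ?_
  · exact congr_arg (fun T : H →L[ℂ] H => T x) this
  · obtain ⟨y, hy⟩ := S.exists_graph_D hx
    obtain ⟨y', hy'⟩ := S.exists_graph_D (hΓ.map_domain x hx)
    change Z (S.U z (S.proj k x)) = S.U z (Z (S.proj k x))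
    rw [S.mem_Hk_iff.1 (S.proj_mem_Hk k x), map_smul, hZ.apply_proj hΓ hy hy',
      S.mem_Hk_iff.1 (S.proj_mem_Hk k _)]

/-- `Dom D ⊆ Dom δ`. -/
theorem HasConstantFibres.exists_graph_delta (hΓ : S.IsProjectable Γ)
    (hZ : S.HasConstantFibres Γ Z) {x : H} (hx : x ∈ S.D.domain) :
    ∃ d, (x, d) ∈ S.delta.graph := by
  obtain ⟨y, hy⟩ := S.exists_graph_D hx
  obtain ⟨y', hy'⟩ := S.exists_graph_D (hΓ.map_domain x hx)
  -- The witness is the value that `Zx = ½(D + ΓDΓ)x - Γδx` forces on `δx`.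
  refine ⟨Γ ((1 / 2 : ℂ) • (y + Γ y') - Z x), S.graph_delta_iff.2 fun k => ?_⟩
  rw [← S.proj_comm hΓ.comm_unitary, map_sub, ← S.proj_comm (hZ.comm_unitary hΓ),
    hZ.apply_proj hΓ hy hy', ← map_sub, sub_sub_cancel, map_smul, map_smul,
    ← S.proj_comm hΓ.comm_unitary, hΓ.apply_apply]

/-- The derivative at `0` of the constant function `⟨U x, U x'⟩`. -/
theorem inner_delta {x d x' d' : H} (h : (x, d) ∈ S.delta.graph) (h' : (x', d') ∈ S.delta.graph) :
    inner ℂ d x' = inner ℂ x d' := by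
  have h1 := (mem_graph_generator.1 h).inner ℂ (mem_graph_generator.1 h')
  simp only [LinearIsometryEquiv.inner_map_map, Circle.exp_zero, map_one,
    LinearIsometryEquiv.coe_one, id_eq, inner_smul_left, inner_smul_right, Complex.conj_I] at h1
  have h2 := h1.unique (hasDerivAt_const _ _)
  refine mul_left_cancel₀ Complex.I_ne_zero ?_
  linear_combination -h2

theorem IsProjectable.inner_eq (hΓ : S.IsProjectable Γ) (x y : H) :
    inner ℂ (Γ x) y = inner ℂ x (Γ y) := by
  rw [← ContinuousLinearMap.adjoint_inner_right, ← ContinuousLinearMap.star_eq_adjoint,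
    hΓ.selfAdjoint.star_eq]

/-- On the dense subspace `Dom D`, `Z = ½(D + ΓDΓ) - Γδ` is a sum of symmetric operators, `Γδ` being
symmetric because `Γ` is selfadjoint and commutes with `δ`. -/
theorem HasConstantFibres.adjoint_eq (hΓ : S.IsProjectable Γ) (hZ : S.HasConstantFibres Γ Z) :
    ContinuousLinearMap.adjoint Z = Z := by
  refine DFunLike.coe_injective ((ContinuousLinearMap.continuous _).ext_on S.dense_domain_D
    (ContinuousLinearMap.continuous _) fun x hx => ?_)
  refine S.dense_domain_D.eq_of_inner_right ℂ fun y hy => ?_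
  obtain ⟨x₁, hx₁⟩ := S.exists_graph_D hx
  obtain ⟨x₂, hx₂⟩ := S.exists_graph_D (hΓ.map_domain x hx)
  obtain ⟨d, hd⟩ := hZ.exists_graph_delta hΓ hx
  obtain ⟨y₁, hy₁⟩ := S.exists_graph_D hy
  obtain ⟨y₂, hy₂⟩ := S.exists_graph_D (hΓ.map_domain y hy)
  obtain ⟨e, he⟩ := hZ.exists_graph_delta hΓ hy
  have hΓd := graph_of_isCommutator hΓ.comm_delta hd
  rw [zero_apply, add_zero] at hΓd
  have h1 := S.mem_graph_D_iff.1 hx₁ _ hy₁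
  have h2 := S.mem_graph_D_iff.1 hx₂ _ hy₂
  have h3 := inner_delta he hΓd
  rw [ContinuousLinearMap.adjoint_inner_right, hZ.apply_eq hΓ hx₁ hx₂ hd,
    hZ.apply_eq hΓ hy₁ hy₂ he]
  simp only [inner_sub_left, inner_sub_right, inner_add_left, inner_add_right, inner_smul_left,
    inner_smul_right, hΓ.inner_eq, map_div₀, map_one, map_ofNat] at h1 h2 h3 ⊢
  linear_combination (1 / 2 : ℂ) * h1 + (1 / 2 : ℂ) * h2 - h3

end Fibres

/-! ### The operator `D + Wδ - Z`: restrictions to `H_k` and closability. -/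

section Formula

variable {S} {Γ Z ω : H →L[ℂ] H}

theorem mem_graph_twistFormula {x v : H} : (x, v) ∈ (S.twistFormula Z ω).graph ↔
    ∃ y d, (x, y) ∈ S.D.graph ∧ (x, d) ∈ S.delta.graph ∧
      v = y + antiConj S.J (ContinuousLinearMap.adjoint ω) d - Z x := by
  rw [LinearPMap.mem_graph_iff]
  constructor
  · rintro ⟨⟨x, hx⟩, rfl, rfl⟩
    exact ⟨_, _, S.D.mem_graph ⟨x, hx.1.1⟩, S.delta.mem_graph ⟨x, hx.1.2⟩, rfl⟩
  · rintro ⟨y, d, hy, hd, rfl⟩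
    have h1 := S.D.mem_domain_of_mem_graph hy
    have h2 := S.delta.mem_domain_of_mem_graph hd
    refine ⟨⟨x, ⟨h1, h2⟩, trivial⟩, rfl, ?_⟩
    rw [S.D.mem_graph_snd_inj hy (S.D.mem_graph ⟨x, h1⟩) rfl,
      S.delta.mem_graph_snd_inj hd (S.delta.mem_graph ⟨x, h2⟩) rfl]
    rfl

theorem domain_twistFormula (hΓ : S.IsProjectable Γ) (hZ : S.HasConstantFibres Γ Z) :
    (S.twistFormula Z ω).domain = S.D.domain := by
  refine le_antisymm (fun x hx => hx.1.1) fun x hx => ⟨⟨hx, ?_⟩, trivial⟩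
  obtain ⟨d, hd⟩ := hZ.exists_graph_delta hΓ hx
  exact S.delta.mem_domain_of_mem_graph hd

theorem IsStrongConnection.comm_unitary (hω : S.IsStrongConnection ω) (z : Circle) (x : H) :
    ω (S.U z x) = S.U z (ω x) :=
  commutes_of_isCommutator_generator S.U_continuous hω.invariant z x

theorem IsStrongConnection.antiConj_comm_unitary (hω : S.IsStrongConnection ω) (z : Circle)
    (x : H) : antiConj S.J (ContinuousLinearMap.adjoint ω) (S.U z x) =
      S.U z (antiConj S.J (ContinuousLinearMap.adjoint ω) x) := by
  rw [antiConj_apply, J_symm_unitary, adjoint_comm_unitary hω.comm_unitary, S.J_equivariant,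
    antiConj_apply]

theorem mem_graph_twistFormula_of_mem_Hk {k : ℤ} {x y : H} (h : (x, y) ∈ S.D.graph)
    (hx : x ∈ S.Hk k) : (x, y + antiConj S.J (ContinuousLinearMap.adjoint ω) ((k : ℂ) • x) - Z x)
      ∈ (S.twistFormula Z ω).graph :=
  mem_graph_twistFormula.2 ⟨y, _, h, S.graph_delta_of_mem_Hk hx, rfl⟩

theorem graph_twistFormula_proj (hΓ : S.IsProjectable Γ) (hZ : S.HasConstantFibres Γ Z)
    (hω : S.IsStrongConnection ω) {x v : H} (h : (x, v) ∈ (S.twistFormula Z ω).graph) (k : ℤ) :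
    (S.proj k x, S.proj k v) ∈ (S.twistFormula Z ω).graph := by
  obtain ⟨y, d, hy, hd, rfl⟩ := mem_graph_twistFormula.1 h
  convert mem_graph_twistFormula_of_mem_Hk (S.graph_D_proj k hy) (S.proj_mem_Hk k x) using 2
  rw [map_sub, map_add, ← S.graph_delta_iff.1 hd k, S.proj_comm hω.antiConj_comm_unitary,
    S.proj_comm (hZ.comm_unitary hΓ)]

theorem mem_graph_domRestrict {H : Type*} [NormedAddCommGroup H] [InnerProductSpace ℂ H] {f : H →ₗ.[ℂ] H} {V : Submodule ℂ H} {v : H × H} :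
    v ∈ (f.domRestrict V).graph ↔ v ∈ f.graph ∧ v.1 ∈ V := by
  obtain ⟨x, y⟩ := v
  simp only [LinearPMap.mem_graph_iff]
  constructor
  · rintro ⟨⟨x, hx⟩, rfl, rfl⟩
    exact ⟨⟨⟨x, hx.2⟩, rfl, rfl⟩, hx.1⟩
  · rintro ⟨⟨⟨x, hx⟩, rfl, rfl⟩, hV⟩
    exact ⟨⟨x, hV, hx⟩, rfl, rfl⟩

/-- On `H_k` the operator `D + J ω* J⁻¹ δ - Z` is a bounded perturbation of `D`. -/
theorem mem_graph_twistFormula_domRestrict {k : ℤ} {v : H × H} :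
    v ∈ ((S.twistFormula Z ω).domRestrict (S.Hk k)).graph ↔ v.1 ∈ S.Hk k ∧
      (v.1, v.2 - antiConj S.J (ContinuousLinearMap.adjoint ω) ((k : ℂ) • v.1) + Z v.1)
        ∈ S.D.graph := by
  obtain ⟨x, v⟩ := v
  rw [mem_graph_domRestrict]
  constructor
  · rintro ⟨h, hx : x ∈ S.Hk k⟩
    obtain ⟨y, d, hy, hd, rfl⟩ := mem_graph_twistFormula.1 h
    obtain rfl := S.graph_delta_unique hd (S.graph_delta_of_mem_Hk hx)
    refine ⟨hx, ?_⟩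
    simp only [sub_right_comm _ (Z x), add_sub_cancel_right, sub_add_cancel]
    exact hy
  · rintro ⟨hx : x ∈ S.Hk k, h⟩
    refine ⟨?_, hx⟩
    convert mem_graph_twistFormula_of_mem_Hk h hx using 2
    abel

theorem isClosed_Hk (k : ℤ) : IsClosed (S.Hk k : Set H) := by
  have : (S.Hk k : Set H) = ⋂ z : Circle, {x | S.U z x = (z : ℂ) ^ k • x} := by
    ext x
    simp [S.mem_Hk_iff]
  rw [this]
  exact isClosed_iInter fun z => isClosed_eq (S.U z).continuous (continuous_const_smul _)

/-- The graph is the preimage of the closed graph of `D` under a continuous shear, cut down to the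
closed subspace `H_k`. -/
theorem isClosed_domRestrict_Hk (k : ℤ) :
    ((S.twistFormula Z ω).domRestrict (S.Hk k)).IsClosed := by
  have : (((S.twistFormula Z ω).domRestrict (S.Hk k)).graph : Set (H × H)) =
      (Prod.fst ⁻¹' (S.Hk k : Set H)) ∩ (fun v : H × H => (v.1, v.2 -
        antiConj S.J (ContinuousLinearMap.adjoint ω) ((k : ℂ) • v.1) + Z v.1)) ⁻¹'
          (S.D.graph : Set (H × H)) := by
    ext v
    exact mem_graph_twistFormula_domRestrict
  rw [LinearPMap.IsClosed, this]
  exact ((isClosed_Hk k).preimage continuous_fst).inter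
    (S.graph_D_closed.preimage (by fun_prop))

theorem isClosable_iff_forall {H : Type*} [NormedAddCommGroup H] [InnerProductSpace ℂ H]
    {f : H →ₗ.[ℂ] H} :
    f.IsClosable ↔ ∀ v ∈ f.graph.topologicalClosure, v.1 = 0 → v.2 = 0 := by
  constructor
  · rintro ⟨g, hg⟩ v hv h0
    rw [hg] at hv
    exact g.graph_fst_eq_zero_snd hv h0
  · exact fun h => ⟨_, (Submodule.toLinearPMap_graph_eq _ h).symm⟩

/-- Taking the closure adds nothing on a single `H_k`: the projection maps the graph into a graph
that is already closed. -/
theorem proj_mem_domRestrict_of_mem_closure (hΓ : S.IsProjectable Γ)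
    (hZ : S.HasConstantFibres Γ Z) (hω : S.IsStrongConnection ω) {v : H × H}
    (hv : v ∈ (S.twistFormula Z ω).graph.topologicalClosure) (k : ℤ) :
    (S.proj k v.1, S.proj k v.2) ∈ ((S.twistFormula Z ω).domRestrict (S.Hk k)).graph := by
  have hc : Continuous fun v : H × H => (S.proj k v.1, S.proj k v.2) := by fun_prop
  have := map_mem_closure (t := (((S.twistFormula Z ω).domRestrict (S.Hk k)).graph : Set (H × H)))
    hc hv fun w hw => mem_graph_domRestrict.2
      ⟨graph_twistFormula_proj hΓ hZ hω hw k, S.proj_mem_Hk k _⟩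
  rwa [(isClosed_domRestrict_Hk k).closure_eq] at this

theorem isClosable_twistFormula (hΓ : S.IsProjectable Γ) (hZ : S.HasConstantFibres Γ Z)
    (hω : S.IsStrongConnection ω) : (S.twistFormula Z ω).IsClosable := by
  refine isClosable_iff_forall.2 fun v hv h0 => eq_of_weightProj_eq S.U_continuous fun k => ?_
  have h := proj_mem_domRestrict_of_mem_closure hΓ hZ hω hv k
  rw [h0, map_zero] at h
  rw [map_zero]
  exact LinearPMap.graph_fst_eq_zero_snd _ h rfl

end Formula

/-! ### The decomposition of `1` furnished by the Hopf–Galois property. -/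

section HopfGalois

/-- The component of degree zero of a polynomial element. -/
def invariantPart : S.Pol →ₗ[ℂ] A :=
  (S.homog 0).subtype ∘ₗ DirectSum.component ℂ ℤ (fun k => S.homog k) 0 ∘ₗ
    S.decomp.symm.toLinearMap

theorem invariantPart_incl (k : ℤ) (a : S.homog k) :
    S.invariantPart (S.incl k a) = if k = 0 then (a : A) else 0 := by
  have h : S.decomp.symm (S.incl k a) = DirectSum.lof ℂ ℤ (fun k => S.homog k) k a := by
    rw [LinearEquiv.symm_apply_eq, DirectSum.lof_eq_of, decomp_of]
  simp only [invariantPart, LinearMap.comp_apply, LinearEquiv.coe_coe, h]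
  split_ifs with hk
  · subst hk
    simp [DirectSum.component.lof_self]
  · rw [DirectSum.component.of, dif_neg hk, map_zero]

/-- The map `x ⊗ p ↦ pₖ x₀`, where `pₖ` is a coefficient of `p` and `x₀` the invariant part
of `x`. -/
def invariantCoeff (k : ℤ) : S.Pol ⊗[ℂ] LaurentPolynomial ℂ →ₗ[ℂ] A :=
  TensorProduct.lift (((LinearMap.lsmul ℂ A).flip ∘ₗ S.invariantPart).compl₂
    ({ toFun := fun p => p.coeff k
       map_add' := fun _ _ => rfl
       map_smul' := fun _ _ => rfl } : LaurentPolynomial ℂ →ₗ[ℂ] ℂ))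

theorem invariantCoeff_tmul (k : ℤ) (x : S.Pol) (p : LaurentPolynomial ℂ) :
    S.invariantCoeff k (x ⊗ₜ p) = p.coeff k • S.invariantPart x := rfl

/-- For `a`, `b` of degrees `i`, `j` the image of `a ⊗ b` is `ab ⊗ zʲ`; the coefficient at `k`
requires `j = k`, the invariant part `i = -j`. -/
theorem invariantCoeff_preCanonicalMap_mem (k : ℤ) (t : S.Pol ⊗[ℂ] S.Pol) :
    S.invariantCoeff k (S.preCanonicalMap t) ∈
      Submodule.span ℂ {c | ∃ p ∈ S.homog (-k), ∃ q ∈ S.homog k, c = p * q} := by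
  induction t using TensorProduct.induction_on with
  | zero => simp
  | add t t' h h' => rw [map_add, map_add]; exact Submodule.add_mem _ h h'
  | tmul x y =>
    obtain ⟨x, rfl⟩ := S.decomp.surjective x
    obtain ⟨y, rfl⟩ := S.decomp.surjective y
    induction x using DirectSum.induction_on with
    | zero => simp
    | add x x' h h' =>
      rw [map_add, TensorProduct.add_tmul, map_add, map_add]; exact Submodule.add_mem _ h h'
    | of i a =>
    induction y using DirectSum.induction_on with
    | zero => simp
    | add y y' h h' =>
      rw [map_add, TensorProduct.tmul_add, map_add, map_add]; exact Submodule.add_mem _ h h'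
    | of j b =>
    rw [decomp_of, decomp_of, preCanonicalMap, TensorProduct.lift.tmul]
    simp only [LinearMap.compl₁₂_apply, LinearMap.flip_apply, TensorProduct.mk_apply,
      LinearMap.mul_apply', coaction_incl, Algebra.TensorProduct.tmul_mul_tmul, one_mul]
    have h : S.incl i a * S.incl j b =
      S.incl (i + j) ⟨(a : A) * b, SetLike.mul_mem_graded a.2 b.2⟩ := rfl
    rw [h, invariantCoeff_tmul, invariantPart_incl, LaurentPolynomial.T_apply]
    split_ifs with hj hij
    · subst hj
      obtain rfl := eq_neg_of_add_eq_zero_left hij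
      rw [one_smul]
      exact Submodule.subset_span ⟨a, a.2, b, b.2, rfl⟩
    all_goals simp

/-- Surjectivity of the canonical map provides a preimage of `1 ⊗ zᵏ`, whose extracted coefficient
is `1`. -/
theorem one_mem_span_of_isHopfGalois (h : S.IsHopfGalois) (k : ℤ) :
    (1 : A) ∈ Submodule.span ℂ {c | ∃ p ∈ S.homog (-k), ∃ q ∈ S.homog k, c = p * q} := by
  obtain ⟨t, ht⟩ := h.2 (1 ⊗ₜ LaurentPolynomial.T k)
  obtain ⟨t, rfl⟩ := Submodule.Quotient.mk_surjective _ t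
  have h1 : S.preCanonicalMap t = 1 ⊗ₜ LaurentPolynomial.T k := ht
  have h2 : (1 : S.Pol) = S.incl 0 ⟨1, SetLike.GradedOne.one_mem⟩ := rfl
  have h3 := S.invariantCoeff_preCanonicalMap_mem k t
  rw [h1, invariantCoeff_tmul, h2, invariantPart_incl, LaurentPolynomial.T_apply] at h3
  simpa using h3

end HopfGalois

/-! ### Identification of the twisted Dirac operators with `D + Wδ - Z` and its restrictions. -/

section Twist

variable {S} {Γ Z ω : H →L[ℂ] H}

theorem dirac0_apply (hZ : S.HasConstantFibres Γ Z) (h : (S.dirac0 Γ).domain) {y : H}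
    (hy : ((h : H), y) ∈ S.D.graph) : S.dirac0 Γ h = y - Z h := by
  obtain ⟨h, hH, hD⟩ := h
  have hδ := S.graph_delta_of_mem_Hk hH
  have hδ' := S.delta.mem_domain_of_mem_graph hδ
  have h1 := hZ.decomp h hD.1 hD hδ'
  have h2 : S.delta ⟨h, hδ'⟩ = 0 := by
    rw [← S.delta.mem_graph_snd_inj hδ (S.delta.mem_graph ⟨h, hδ'⟩) rfl]
    simp
  rw [h2, map_zero, sub_zero,
    ← S.D.mem_graph_snd_inj hy (S.D.mem_graph ⟨h, hD.1⟩) rfl] at h1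
  change S.horizontalDirac Γ ⟨h, hD⟩ = y - Z h
  rw [← h1, sub_sub_cancel]

/-- The right-hand side is `(D + kW - Z)(hp)`, by the Leibniz rule, so the prescription depends only
on the vector `hp`. -/
theorem twist_pair_eq (hZ : S.HasConstantFibres Γ Z) (h : (S.dirac0 Γ).domain) {y : H}
    (hy : ((h : H), y) ∈ S.D.graph) (k : ℤ) (p : A) :
    S.rightAct p (S.dirac0 Γ h) + S.rightForm (S.nabla ω k p) h =
      S.rightAct p y + S.rightForm (S.dD p) h +
        antiConj S.J (ContinuousLinearMap.adjoint ω) ((k : ℂ) • S.rightAct p h) -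
          Z (S.rightAct p h) := by
  have h1 : Z (S.rightAct p h) = S.rightAct p (Z h) :=
    congr_arg (fun T : H →L[ℂ] H => T h) (hZ.comm p)
  rw [dirac0_apply hZ h hy, rightForm_nabla, map_sub, h1]
  abel

theorem twistGraph_eq (hHG : S.IsHopfGalois) (hΓ : S.IsProjectable Γ)
    (hZ : S.HasConstantFibres Γ Z) (k : ℤ) :
    S.twistGraph Γ ω k = ((S.twistFormula Z ω).domRestrict (S.Hk k)).graph := by
  have hle : S.twistGraph Γ ω k ≤ ((S.twistFormula Z ω).domRestrict (S.Hk k)).graph := by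
    refine Submodule.span_le.2 ?_
    rintro _ ⟨h, p, hp, rfl⟩
    obtain ⟨y, hy⟩ := S.exists_graph_D h.2.2.1
    have hk : S.rightAct p h ∈ S.Hk k := by simpa using S.rightAct_mem_Hk hp h.2.1
    rw [twist_pair_eq hZ h hy]
    exact mem_graph_domRestrict.2
      ⟨mem_graph_twistFormula_of_mem_Hk (S.graph_D_rightAct p hy) hk, hk⟩
  refine le_antisymm hle ?_
  rintro ⟨x, v⟩ hv
  have hx : x ∈ S.Hk k := (mem_graph_domRestrict.1 hv).2
  have hxD : x ∈ S.D.domain :=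
    S.D.mem_domain_of_mem_graph (mem_graph_twistFormula_domRestrict.1 hv).2
  obtain ⟨y, hy⟩ := S.exists_graph_D hxD
  -- It suffices that `xc` occurs as a first component. For `c = 1` the second component is then
  -- forced by the inclusion `hle` into the graph of an operator.
  have key : ∀ c ∈ Submodule.span ℂ {c | ∃ p ∈ S.homog (-k), ∃ q ∈ S.homog k, c = p * q},
      ∃ w, (S.rightAct c x, w) ∈ S.twistGraph Γ ω k := by
    intro c hc
    induction hc using Submodule.span_induction with
    | mem c hc =>
      obtain ⟨p, hp, q, hq, rfl⟩ := hc
      have h0 : S.rightAct p x ∈ S.Hk 0 := by simpa using S.rightAct_mem_Hk hp hx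
      have hD : S.rightAct p x ∈ (S.horizontalDirac Γ).domain := by
        rw [hΓ.domain_horizontalDirac]
        exact S.D.mem_domain_of_mem_graph (S.graph_D_rightAct p hy)
      rw [rightAct_mul]
      exact ⟨_, Submodule.subset_span ⟨⟨_, h0, hD⟩, q, hq, rfl⟩⟩
    | zero =>
      refine ⟨0, ?_⟩
      have : S.rightAct 0 x = 0 := by simpa using S.rightAct_smul 0 0 x
      rw [this]
      exact Submodule.zero_mem _
    | add c c' _ _ h h' =>
      obtain ⟨w, hw⟩ := h
      obtain ⟨w', hw'⟩ := h'
      rw [rightAct_add]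
      exact ⟨w + w', Submodule.add_mem _ hw hw'⟩
    | smul r c _ h =>
      obtain ⟨w, hw⟩ := h
      rw [rightAct_smul]
      exact ⟨r • w, Submodule.smul_mem _ r hw⟩
  obtain ⟨w, hw⟩ := key 1 (S.one_mem_span_of_isHopfGalois hHG k)
  rw [rightAct_one] at hw
  rwa [LinearPMap.mem_graph_snd_inj _ hv (hle hw) rfl]

theorem closure_eq_of_isClosed {H : Type*} [NormedAddCommGroup H] [InnerProductSpace ℂ H]
    {f : H →ₗ.[ℂ] H} (hf : f.IsClosed) : f.closure = f := by
  refine LinearPMap.eq_of_eq_graph ?_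
  rw [← hf.isClosable.graph_closure_eq_closure_graph]
  exact IsClosed.submodule_topologicalClosure_eq hf

theorem twistedDiracOn_eq (hHG : S.IsHopfGalois) (hΓ : S.IsProjectable Γ)
    (hZ : S.HasConstantFibres Γ Z) (k : ℤ) :
    S.twistedDiracOn Γ ω k = (S.twistFormula Z ω).domRestrict (S.Hk k) := by
  have h : (S.twistGraph Γ ω k).toLinearPMap = (S.twistFormula Z ω).domRestrict (S.Hk k) := by
    refine LinearPMap.eq_of_eq_graph ?_
    rw [twistGraph_eq hHG hΓ hZ]
    exact Submodule.toLinearPMap_graph_eq _ fun v hv h0 => LinearPMap.graph_fst_eq_zero_snd _ hv h0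
  rw [twistedDiracOn, h, closure_eq_of_isClosed (isClosed_domRestrict_Hk k)]

theorem directSumGraph_le (hHG : S.IsHopfGalois) (hΓ : S.IsProjectable Γ)
    (hZ : S.HasConstantFibres Γ Z) : S.directSumGraph Γ ω ≤ (S.twistFormula Z ω).graph := by
  refine iSup_le fun k v hv => ?_
  rw [twistedDiracOn_eq hHG hΓ hZ] at hv
  exact (mem_graph_domRestrict.1 hv).1

/-- Each component lies in the algebraic direct sum, and a closed subspace containing all components
contains the pair. -/
theorem mem_closure_directSumGraph (hHG : S.IsHopfGalois) (hΓ : S.IsProjectable Γ)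
    (hZ : S.HasConstantFibres Γ Z) {v : H × H} (h : ∀ k : ℤ, (S.proj k v.1, S.proj k v.2) ∈
      ((S.twistFormula Z ω).domRestrict (S.Hk k)).graph) :
    v ∈ (S.directSumGraph Γ ω).topologicalClosure := by
  refine pair_mem_of_weightProj_mem S.U_continuous (Submodule.isClosed_topologicalClosure _)
    fun k => Submodule.le_topologicalClosure _ ?_
  refine Submodule.mem_iSup_of_mem k ?_
  rw [twistedDiracOn_eq hHG hΓ hZ]
  exact h k

theorem closure_directSumGraph (hHG : S.IsHopfGalois) (hΓ : S.IsProjectable Γ)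
    (hZ : S.HasConstantFibres Γ Z) (hω : S.IsStrongConnection ω) :
    (S.directSumGraph Γ ω).topologicalClosure =
      (S.twistFormula Z ω).graph.topologicalClosure :=
  le_antisymm (Submodule.topologicalClosure_mono (directSumGraph_le hHG hΓ hZ)) fun _ hv =>
    mem_closure_directSumGraph hHG hΓ hZ (proj_mem_domRestrict_of_mem_closure hΓ hZ hω hv)

theorem graph_toLinearPMap_directSumGraph (hHG : S.IsHopfGalois) (hΓ : S.IsProjectable Γ)
    (hZ : S.HasConstantFibres Γ Z) :
    (S.directSumGraph Γ ω).toLinearPMap.graph = S.directSumGraph Γ ω :=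
  Submodule.toLinearPMap_graph_eq _ fun _ hv h0 =>
    LinearPMap.graph_fst_eq_zero_snd _ (directSumGraph_le hHG hΓ hZ hv) h0

theorem twistedDirac_eq (hHG : S.IsHopfGalois) (hΓ : S.IsProjectable Γ)
    (hZ : S.HasConstantFibres Γ Z) (hω : S.IsStrongConnection ω) :
    S.twistedDirac Γ ω = (S.twistFormula Z ω).closure := by
  have hF := isClosable_twistFormula hΓ hZ hω
  have hg := graph_toLinearPMap_directSumGraph (ω := ω) hHG hΓ hZ
  have hle : (S.directSumGraph Γ ω).toLinearPMap ≤ S.twistFormula Z ω := by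
    rw [← LinearPMap.le_graph_iff, hg]
    exact directSumGraph_le hHG hΓ hZ
  refine LinearPMap.eq_of_eq_graph ?_
  rw [twistedDirac, ← (hF.leIsClosable hle).graph_closure_eq_closure_graph,
    ← hF.graph_closure_eq_closure_graph, hg, closure_directSumGraph hHG hΓ hZ hω]

/-! ### Selfadjointness of the closure for selfadjoint `ω`. -/

theorem inner_antiunitary {H : Type*} [NormedAddCommGroup H] [InnerProductSpace ℂ H]
    (J : H ≃ₗᵢ⋆[ℂ] H) (x y : H) : inner ℂ (J x) (J y) = inner ℂ y x := by
  have h1 : ‖J x + J y‖ = ‖x + y‖ := by rw [← map_add, J.norm_map]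
  have h2 : ‖J x - J y‖ = ‖x - y‖ := by rw [← map_sub, J.norm_map]
  have h3 : ‖J x - Complex.I • J y‖ = ‖x + Complex.I • y‖ := by
    rw [← J.norm_map (x + _), map_add, map_smulₛₗ, Complex.conj_I, neg_smul, sub_eq_add_neg]
  have h4 : ‖J x + Complex.I • J y‖ = ‖x - Complex.I • y‖ := by
    rw [← J.norm_map (x - _), map_sub, map_smulₛₗ, Complex.conj_I, neg_smul, sub_neg_eq_add]
  rw [← inner_conj_symm y x, inner_eq_sum_norm_sq_div_four, inner_eq_sum_norm_sq_div_four x y]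
  simp only [RCLike.I_to_complex, h1, h2, h3, h4, map_div₀, map_add, map_sub, map_mul, map_pow,
    Complex.coe_algebraMap, Complex.conj_ofReal, Complex.conj_I,
    map_ofNat]
  simp
  ring

theorem adjoint_antiConj (J : H ≃ₗᵢ⋆[ℂ] H) (T : H →L[ℂ] H) :
    ContinuousLinearMap.adjoint (antiConj J T) = antiConj J (ContinuousLinearMap.adjoint T) := by
  refine ((ContinuousLinearMap.eq_adjoint_iff _ _).2 fun x y => ?_).symm
  rw [antiConj_apply, antiConj_apply]
  conv_lhs => rw [← J.apply_symm_apply y]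
  conv_rhs => rw [← J.apply_symm_apply x]
  rw [inner_antiunitary, inner_antiunitary, ContinuousLinearMap.adjoint_inner_right]

theorem antiConj_inner_of_isSelfAdjoint (J : H ≃ₗᵢ⋆[ℂ] H) {T : H →L[ℂ] H}
    (hT : IsSelfAdjoint T) (x y : H) :
    inner ℂ (antiConj J (ContinuousLinearMap.adjoint T) x) y =
      inner ℂ x (antiConj J (ContinuousLinearMap.adjoint T) y) := by
  rw [← ContinuousLinearMap.adjoint_inner_right, adjoint_antiConj]
  simp only [← ContinuousLinearMap.star_eq_adjoint, hT.star_eq]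

theorem HasConstantFibres.inner_eq (hΓ : S.IsProjectable Γ) (hZ : S.HasConstantFibres Γ Z)
    (x y : H) : inner ℂ (Z x) y = inner ℂ x (Z y) := by
  rw [← ContinuousLinearMap.adjoint_inner_right, hZ.adjoint_eq hΓ]

theorem inner_twistFormula (hΓ : S.IsProjectable Γ) (hZ : S.HasConstantFibres Γ Z)
    (hω : S.IsStrongConnection ω) (hsa : IsSelfAdjoint ω) {u v : H × H}
    (hu : u ∈ (S.twistFormula Z ω).graph) (hv : v ∈ (S.twistFormula Z ω).graph) :
    inner ℂ u.2 v.1 = inner ℂ u.1 v.2 := by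
  obtain ⟨x, u⟩ := u
  obtain ⟨x', v⟩ := v
  obtain ⟨y, d, hy, hd, rfl⟩ := mem_graph_twistFormula.1 hu
  obtain ⟨y', d', hy', hd', rfl⟩ := mem_graph_twistFormula.1 hv
  -- `W` preserves `Dom δ` and commutes with `δ`, so `Wδ` is symmetric along with `W` and `δ`.
  have hW : (antiConj S.J (ContinuousLinearMap.adjoint ω) x',
      antiConj S.J (ContinuousLinearMap.adjoint ω) d') ∈ S.delta.graph := by
    refine S.graph_delta_iff.2 fun k => ?_
    rw [← S.proj_comm hω.antiConj_comm_unitary, ← S.proj_comm hω.antiConj_comm_unitary,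
      S.graph_delta_iff.1 hd' k, map_smul]
  have h1 := S.mem_graph_D_iff.1 hy' _ hy
  have h2 := inner_delta hd hW
  simp only [inner_sub_left, inner_sub_right, inner_add_left, inner_add_right,
    antiConj_inner_of_isSelfAdjoint S.J hsa, hZ.inner_eq hΓ] at h1 h2 ⊢
  rw [h1, h2]

theorem isSelfAdjoint_closure_twistFormula (hHG : S.IsHopfGalois) (hΓ : S.IsProjectable Γ)
    (hZ : S.HasConstantFibres Γ Z) (hω : S.IsStrongConnection ω) (hsa : IsSelfAdjoint ω) :
    IsSelfAdjoint (S.twistFormula Z ω).closure := by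
  have hF := isClosable_twistFormula hΓ hZ hω
  have hdense : Dense ((S.twistFormula Z ω).closure.domain : Set H) := by
    refine S.dense_domain_D.mono ?_
    rw [← domain_twistFormula (ω := ω) hΓ hZ]
    exact (S.twistFormula Z ω).le_closure.1
  rw [LinearPMap.isSelfAdjoint_def]
  refine LinearPMap.eq_of_eq_graph ?_
  rw [LinearPMap.adjoint_graph_eq_graph_adjoint hdense, ← hF.graph_closure_eq_closure_graph]
  refine le_antisymm (fun v hv => ?_) fun v hv => ?_
  · rw [Submodule.mem_adjoint_iff] at hv
    rw [← closure_directSumGraph hHG hΓ hZ hω]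
    refine mem_closure_directSumGraph hHG hΓ hZ fun k => ?_
    refine mem_graph_twistFormula_domRestrict.2 ⟨S.proj_mem_Hk k _, S.mem_graph_D_iff.2 ?_⟩
    rintro ⟨x, y⟩ hxy
    have hP (a b : H) : inner ℂ (S.proj k a) b = inner ℂ a (S.proj k b) :=
      inner_weightProj S.U_continuous k a b
    -- Testing the adjoint relation on projected vectors of `Dom D` moves the projection and the
    -- bounded symmetric terms to the other side; what remains is the criterion for `D = D*`.
    have h := hv _ _ (Submodule.le_topologicalClosure _
      (mem_graph_twistFormula_of_mem_Hk (S.graph_D_proj k hxy) (S.proj_mem_Hk k x)))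
    simp only [inner_sub_left, inner_add_left, inner_sub_right, inner_add_right, map_smul,
      inner_smul_left, inner_smul_right, map_intCast, antiConj_inner_of_isSelfAdjoint S.J hsa,
      hZ.inner_eq hΓ, hP, S.proj_comm hω.antiConj_comm_unitary,
      S.proj_comm (hZ.comm_unitary hΓ)] at h ⊢
    linear_combination h
  -- Symmetry extends to the closure in one variable at a time.
  · have h1 : ∀ u ∈ (S.twistFormula Z ω).graph,
        ∀ w ∈ (S.twistFormula Z ω).graph.topologicalClosure,
          inner ℂ u.2 w.1 = inner ℂ u.1 w.2 := fun u hu w hw =>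
      closure_minimal (t := {w : H × H | inner ℂ u.2 w.1 = inner ℂ u.1 w.2})
        (fun w hw => inner_twistFormula hΓ hZ hω hsa hu hw)
        (isClosed_eq (by fun_prop) (by fun_prop)) hw
    rw [Submodule.mem_adjoint_iff]
    intro a b hab
    rw [sub_eq_zero]
    exact closure_minimal (t := {u : H × H | inner ℂ u.2 v.1 = inner ℂ u.1 v.2})
      (fun u hu => h1 u hu v hv) (isClosed_eq (by fun_prop) (by fun_prop)) hab

/-! ### Bounded commutators with the algebra. -/

theorem commute_antiConj_of_mem_oneForms {η : H →L[ℂ] H} (hη : η ∈ S.oneForms ⊤) (a : A) :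
    Commute η (antiConj S.J (S.rep a)) := by
  rw [← star_star a]
  induction hη using Submodule.span_induction with
  | mem η h =>
    obtain ⟨p, _, q, _, rfl⟩ := h
    exact (S.order_zero p _).mul_left (S.order_one q _)
  | zero => exact Commute.zero_left _
  | add η η' _ _ h h' => exact h.add_left h'
  | smul c η _ h => exact h.smul_left c

/-- As a one-form, `ω` commutes with `J A J⁻¹`, hence so does `ω*`; conjugation by `J`, with `J⁻¹ =
-J`, makes `W` commute with `A`. -/
theorem IsStrongConnection.antiConj_comm_rep (hω : S.IsStrongConnection ω) (a : A) (x : H) :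
    antiConj S.J (ContinuousLinearMap.adjoint ω) (S.rep a x) =
      S.rep a (antiConj S.J (ContinuousLinearMap.adjoint ω) x) := by
  have h1 := (commute_antiConj_of_mem_oneForms hω.mem (star a)).star_star
  rw [ContinuousLinearMap.star_eq_adjoint, ContinuousLinearMap.star_eq_adjoint, adjoint_antiConj,
    ← ContinuousLinearMap.star_eq_adjoint (S.rep _), ← map_star, star_star] at h1
  have h2 : ContinuousLinearMap.adjoint ω (S.J (S.rep a (S.J.symm (S.J.symm x)))) =
      S.J (S.rep a (S.J.symm (ContinuousLinearMap.adjoint ω (S.J.symm x)))) :=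
    congr_arg (fun T : H →L[ℂ] H => T (S.J.symm x)) h1
  simp only [J_symm_apply, map_neg, S.J_sq, neg_neg, antiConj_apply] at h2 ⊢
  rw [← map_neg, h2, S.J_sq]

theorem hasBoundedCommutator_closure_twistFormula (hΓ : S.IsProjectable Γ)
    (hZ : S.HasConstantFibres Γ Z) (hω : S.IsStrongConnection ω) (a : A) :
    HasBoundedCommutator (S.twistFormula Z ω).closure (S.rep a) := by
  set W := antiConj S.J (ContinuousLinearMap.adjoint ω)
  -- This is `[D, a] + W[δ, a] - [Z, a]`; no term `[W, a]δ` appears, which would be unbounded in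
  -- general.
  let C : H →L[ℂ] H := S.dD a + W * S.rep (S.derivA a) - Z * S.rep a + S.rep a * Z
  refine ⟨C, isCommutator_of_graph ?_⟩
  rw [← (isClosable_twistFormula hΓ hZ hω).graph_closure_eq_closure_graph]
  have hc : Continuous fun v : H × H => (S.rep a v.1, S.rep a v.2 + C v.1) := by fun_prop
  refine fun v hv => map_mem_closure (f := fun v : H × H => (S.rep a v.1, S.rep a v.2 + C v.1))
    hc hv ?_
  rintro ⟨x, v⟩ h
  obtain ⟨y, d, hy, hd, rfl⟩ := mem_graph_twistFormula.1 h
  refine mem_graph_twistFormula.2 ⟨_, _, S.graph_D_rep a hy,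
    graph_of_isCommutator (S.rep_equivariant a) hd, ?_⟩
  simp only [C, map_add, map_sub, hω.antiConj_comm_rep]
  simp [W, hω.antiConj_comm_rep]
  abel

end Twist

end EquivariantRealSpectralTriple

end TwistedDirac
end

open TwistedDirac EquivariantRealSpectralTriple in
theorem mainTheorem5 {A H : Type*} [Ring A] [StarRing A] [Algebra ℂ A] [StarModule ℂ A]
    [NormedAddCommGroup H] [InnerProductSpace ℂ H] [CompleteSpace H]
    (S : TwistedDirac.EquivariantRealSpectralTriple A H) (Γ Z ω : H →L[ℂ] H)
    (hHG : S.IsHopfGalois)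
    (hΓ : S.IsProjectable Γ)
    (hcal : S.HasProjectableCalculus Γ)
    (hZ : S.HasConstantFibres Γ Z)
    (hcomp : S.HasCompatibleCalculus)
    (hω : S.IsStrongConnection ω) :
    -- the twists and their direct sum are well defined and closable
    (∀ k : ℤ, (∀ v ∈ S.twistGraph Γ ω k, v.1 = 0 → v.2 = 0) ∧
      (S.twistedDiracOn Γ ω k).graph = (S.twistGraph Γ ω k).topologicalClosure) ∧
    (∀ v ∈ S.directSumGraph Γ ω, v.1 = 0 → v.2 = 0) ∧
    (S.twistedDirac Γ ω).graph = (S.directSumGraph Γ ω).topologicalClosure ∧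
    -- on each eigenspace the twist is the restriction of `D + J ω* J⁻¹ δ - Z`
    (∀ k : ℤ, S.twistedDiracOn Γ ω k = (S.twistFormula Z ω).domRestrict (S.Hk k)) ∧
    -- `D_ω` is the closure of `D + J ω* J⁻¹ δ - Z`, an operator with domain `Dom D`
    (S.twistFormula Z ω).domain = S.D.domain ∧
    (S.twistFormula Z ω).IsClosable ∧
    S.twistedDirac Γ ω = (S.twistFormula Z ω).closure ∧
    -- selfadjointness and bounded commutators
    (IsSelfAdjoint ω → IsSelfAdjoint (S.twistedDirac Γ ω)) ∧
    (∀ a : A, TwistedDirac.HasBoundedCommutator (S.twistedDirac Γ ω) (S.rep a)) := by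
  have hF := isClosable_twistFormula hΓ hZ hω
  refine ⟨fun k => ⟨fun v hv h0 => ?_, ?_⟩, fun v hv h0 => ?_, ?_,
    fun k => twistedDiracOn_eq hHG hΓ hZ k, domain_twistFormula hΓ hZ, hF,
    twistedDirac_eq hHG hΓ hZ hω, fun hsa => ?_, fun a => ?_⟩
  · rw [twistGraph_eq hHG hΓ hZ] at hv
    exact LinearPMap.graph_fst_eq_zero_snd _ hv h0
  · rw [twistedDiracOn_eq hHG hΓ hZ, twistGraph_eq hHG hΓ hZ]
    exact (IsClosed.submodule_topologicalClosure_eq (isClosed_domRestrict_Hk k)).symm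
  · exact LinearPMap.graph_fst_eq_zero_snd _ (directSumGraph_le hHG hΓ hZ hv) h0
  · rw [twistedDirac_eq hHG hΓ hZ hω, closure_directSumGraph hHG hΓ hZ hω,
      hF.graph_closure_eq_closure_graph]
  · rw [twistedDirac_eq hHG hΓ hZ hω]
    exact isSelfAdjoint_closure_twistFormula hHG hΓ hZ hω hsa
  · rw [twistedDirac_eq hHG hΓ hZ hω]
    exact hasBoundedCommutator_closure_twistFormula hΓ hZ hω a
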